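/- **Setting.** For input dimension $d\ge1$, width $N$ and parameters $\theta=(a,W,b,b_0)\in\mathbb R^N\times\mathbb R^{N\times d}\times\mathbb R^N\times\mathbb R$ (with rows $w_\ell$ of $W$) let $$f(x;\theta)=\frac1{\sqrt N}\sum_{\ell=1}^N a_\ell\,\sigma(\langle w_\ell,x\rangle+b_\ell)+b_0 .$$ Here $\sigma:\mathbb R\to\mathbb R$ is $C^2$ with $|\sigma(0)|\le s_0$, $\|\sigma'\|_\infty\le s_1$, $\|\sigma''\|_\infty\le s_2$. Let $\mathcal A,\mathcal W,\mathcal B,\mathcal B'$ be zero-mean, unit-variance laws on $\mathbb R$ with subgaussian norm $\|Y\|_{\psi_2}=\inf\{t>0:\mathbb E\,e^{Y^2/t^2}\le2\}$ at most $K$. Draw independently $a_\ell\sim\mathcal A$, $W_{\ell j}\sim\mathcal W$, $b_\ell\sim\mathcal B$ $(\ell\le m,\ j\le d)$ and $b_0\sim\mathcal B'$, and apply the doubling trick: $\theta_0$ is the parameter of the network of width $N=2m$ with inner weights $(W;W)$, inner biases $(b;b)$, outer weights $(a;-a)$ and outer bias $0$, so that $f(\cdot;\theta_0)\equiv0$.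 Fix training inputs $x_1,\dots,x_n\in\mathbb R^d$, $n\ge1$, with $\|x_i\|_2\le M$, and labels $y_i=f^*(x_i)$ with $|f^*(x_i)|\le B$. Let $\hat r(\theta)_i=f(x_i;\theta)-y_i$ and $\Phi(\theta)=\frac1{2n}\|\hat r(\theta)\|_2^2$, and write $\hat r_t=\hat r(\theta_t)$ for the gradient flow $\partial_t\theta_t=-\nabla\Phi(\theta_t)$, $t\ge0$, started at $\theta_0$; thus $\hat r_0=-y$. Let $$K^\infty(x,x')=\mathbb E\,\langle\partial_\theta f(x;\theta_0),\partial_\theta f(x';\theta_0)\rangle$$ (which does not depend on $m\ge1$), $H^\infty=(K^\infty(x_i,x_j))_{i,j}$, $G^\infty=\frac1nH^\infty$, and let $\lambda_n(H^\infty)$ be the smallest eigenvalue of $H^\infty$. **Theorem.** There is an absolute exponent $k\in\mathbb N$, and for all $M,B,K,s_0,s_1,s_2$ there is a constant $C>0$ depending only on these six numbers, such that the following holds for all $\sigma,\mathcal A,\mathcal W,\mathcal B,\mathcal B',d,n,x_1,\dots,x_n,f^*$ as above, all $\varepsilon>0$, $\delta\in(0,1)$ and $m\in\mathbb N$. Suppose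 $\lambda_n(H^\infty)>0$ and $$m\ \ge\ C\,\frac{d\,n^5}{\varepsilon^2\lambda_n(H^\infty)^4}\,L^k,\qquad L=1+\log d+\log n+\log^+\!\tfrac1\varepsilon+\log^+\!\tfrac1{\lambda_n(H^\infty)}+\log\tfrac1\delta ,$$ where $\log^+=\max(\log,0)$, and $$m\ \ge\ C\big(\log(C/\delta)+d\,(1+\log d)^k\big).$$ Then with probability at least $1-\delta$ over the initialization the gradient flow exists for all $t\ge0$, and it satisfies $$\hat r_t=\exp(-G^\infty t)(-y)+\Delta(t)\quad\text{with}\quad\sup_{t\ge0}\|\Delta(t)\|_2\le\varepsilon .$$ In particular, on the same event, for every orthonormal system $v_1,\dots,v_n$ of eigenvectors of $G^\infty$ with eigenvalues $\lambda_1,\dots,\lambda_n$, and for all $t\ge0$, $$\left|\ \|\hat r_t\|_2-\sqrt{\sum_{i=1}^n e^{-2\lambda_it}\,|\langle y,v_i\rangle|^2}\ \right|\le\varepsilon .$$ -/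

import Mathlib

open MeasureTheory
open scoped ENNReal NNReal Matrix

noncomputable section

namespace ShallowNTK

/-! ### The shallow network and its parameters -/

/-- Index set of the coordinates of a parameter vector `θ = (a, W, b, b₀)` of a shallow network
with neurons indexed by `ι` and inputs in `ℝᵈ`: `a ℓ`, then `W ℓ j`, then `b ℓ`, then `b₀`. -/
abbrev ParamIdx (ι : Type) (d : ℕ) : Type := ι ⊕ (ι × Fin d) ⊕ ι ⊕ Unit

/-- The parameter space `ℝᵖ` with its Euclidean structure. -/
abbrev Param (ι : Type) (d : ℕ) : Type := EuclideanSpace ℝ (ParamIdx ι d)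

/-- Outer weights `a`. -/
def outer {ι : Type} {d : ℕ} (θ : Param ι d) (ℓ : ι) : ℝ := θ (Sum.inl ℓ)

/-- Inner weights `W`. -/
def weight {ι : Type} {d : ℕ} (θ : Param ι d) (ℓ : ι) (j : Fin d) : ℝ :=
  θ (Sum.inr (Sum.inl (ℓ, j)))

/-- Inner biases `b`. -/
def bias {ι : Type} {d : ℕ} (θ : Param ι d) (ℓ : ι) : ℝ := θ (Sum.inr (Sum.inr (Sum.inl ℓ)))

/-- Outer bias `b₀`. -/
def outerBias {ι : Type} {d : ℕ} (θ : Param ι d) : ℝ := θ (Sum.inr (Sum.inr (Sum.inr ())))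

/-- The network `f(x;θ) = N^{-1/2} ∑_ℓ a_ℓ σ(⟨w_ℓ, x⟩ + b_ℓ) + b₀`, where `N` is the number of
neurons. -/
def network {ι : Type} [Fintype ι] {d : ℕ} (σ : ℝ → ℝ) (θ : Param ι d)
    (x : EuclideanSpace ℝ (Fin d)) : ℝ :=
  1 / √(Fintype.card ι : ℝ) *
      ∑ ℓ, outer θ ℓ * σ (∑ j, weight θ ℓ j * x j + bias θ ℓ) + outerBias θ

/-! ### Random initialization -/

/-- The `ψ₂` (subgaussian) norm `inf {t > 0 : 𝔼 exp(Y²/t²) ≤ 2}` of a real random variable with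
law `μ`; it is `∞` if there is no such `t`. -/
def psi2Norm (μ : Measure ℝ) : ℝ≥0∞ :=
  ⨅ (t : ℝ≥0) (_ : 0 < t) (_ : ∫⁻ y, ENNReal.ofReal (Real.exp (y ^ 2 / (t : ℝ) ^ 2)) ∂μ ≤ 2),
    (t : ℝ≥0∞)

/-- `μ` is a zero-mean, unit-variance probability law with subgaussian norm at most `K`. -/
structure IsStdSubgaussian (K : ℝ) (μ : Measure ℝ) : Prop where
  isProbabilityMeasure : IsProbabilityMeasure μ
  mean_eq_zero : ∫ y, y ∂μ = 0
  variance_eq_one : ProbabilityTheory.variance id μ = 1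
  psi2Norm_le : psi2Norm μ ≤ ENNReal.ofReal K

/-- The law of each coordinate of the (undoubled) initial parameters:
`a_ℓ ∼ 𝒜`, `W_{ℓ j} ∼ 𝒲`, `b_ℓ ∼ ℬ`, `b₀ ∼ ℬ'`. -/
def coordLaw (𝒜 𝒲 ℬ ℬ' : Measure ℝ) (m d : ℕ) : ParamIdx (Fin m) d → Measure ℝ
  | Sum.inl _ => 𝒜
  | Sum.inr (Sum.inl _) => 𝒲
  | Sum.inr (Sum.inr (Sum.inl _)) => ℬ
  | Sum.inr (Sum.inr (Sum.inr _)) => ℬ'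

/-- The joint law of the undoubled initial parameters of width `m`: all coordinates independent. -/
def initLaw (𝒜 𝒲 ℬ ℬ' : Measure ℝ) (m d : ℕ) : Measure (ParamIdx (Fin m) d → ℝ) :=
  Measure.pi (coordLaw 𝒜 𝒲 ℬ ℬ' m d)

/-- The doubling trick: `W ↦ (W; W)`, `b ↦ (b; b)`, `a ↦ (a; -a)`, `b₀ ↦ 0`.  The doubled network
has neurons indexed by `Fin m ⊕ Fin m`, so `network` carries the factor `1 / √(2m)`. -/
def double {m d : ℕ} (ω : ParamIdx (Fin m) d → ℝ) : Param (Fin m ⊕ Fin m) d :=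
  WithLp.toLp 2 fun
    | Sum.inl (Sum.inl ℓ) => ω (Sum.inl ℓ)
    | Sum.inl (Sum.inr ℓ) => -ω (Sum.inl ℓ)
    | Sum.inr (Sum.inl (Sum.inl ℓ, j)) => ω (Sum.inr (Sum.inl (ℓ, j)))
    | Sum.inr (Sum.inl (Sum.inr ℓ, j)) => ω (Sum.inr (Sum.inl (ℓ, j)))
    | Sum.inr (Sum.inr (Sum.inl (Sum.inl ℓ))) => ω (Sum.inr (Sum.inr (Sum.inl ℓ)))
    | Sum.inr (Sum.inr (Sum.inl (Sum.inr ℓ))) => ω (Sum.inr (Sum.inr (Sum.inl ℓ)))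
    | Sum.inr (Sum.inr (Sum.inr _)) => 0

/-! ### Gradient flow on the squared loss -/

/-- The label vector `y_i = f*(x_i)`. -/
def labels {d n : ℕ} (x : Fin n → EuclideanSpace ℝ (Fin d))
    (fstar : EuclideanSpace ℝ (Fin d) → ℝ) : EuclideanSpace ℝ (Fin n) :=
  WithLp.toLp 2 fun i => fstar (x i)

/-- The residual vector `r̂(θ)_i = f(x_i;θ) - f*(x_i)`. -/
def residual {ι : Type} [Fintype ι] {d n : ℕ} (σ : ℝ → ℝ) (x : Fin n → EuclideanSpace ℝ (Fin d))
    (fstar : EuclideanSpace ℝ (Fin d) → ℝ) (θ : Param ι d) : EuclideanSpace ℝ (Fin n) :=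
  WithLp.toLp 2 fun i => network σ θ (x i) - fstar (x i)

/-- The loss `Φ(θ) = (1 / 2n) ‖r̂(θ)‖₂²`. -/
def loss {ι : Type} [Fintype ι] {d n : ℕ} (σ : ℝ → ℝ) (x : Fin n → EuclideanSpace ℝ (Fin d))
    (fstar : EuclideanSpace ℝ (Fin d) → ℝ) (θ : Param ι d) : ℝ :=
  1 / (2 * (n : ℝ)) * ‖residual σ x fstar θ‖ ^ 2

/-- `θ` solves the gradient flow `∂ₜ θₜ = -∇Φ(θₜ)` on `[0, ∞)` with initial value `θ₀`. -/
def IsGradientFlow {ι : Type} [Fintype ι] {d n : ℕ} (σ : ℝ → ℝ)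
    (x : Fin n → EuclideanSpace ℝ (Fin d)) (fstar : EuclideanSpace ℝ (Fin d) → ℝ)
    (θ₀ : Param ι d) (θ : ℝ → Param ι d) : Prop :=
  θ 0 = θ₀ ∧ ∀ t, 0 ≤ t →
    HasDerivWithinAt θ (-gradient (loss σ x fstar) (θ t)) (Set.Ici 0) t

/-! ### The analytical neural tangent kernel -/

/-- `K^∞(x, x') = 𝔼 ⟨∂f(x;θ)/∂θ, ∂f(x';θ)/∂θ⟩`, the expectation over the (doubled) random
initialization. Its value is the same for every width `m ≥ 1`. -/
def ntk (σ : ℝ → ℝ) (𝒜 𝒲 ℬ ℬ' : Measure ℝ) (m : ℕ) {d : ℕ}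
    (x x' : EuclideanSpace ℝ (Fin d)) : ℝ :=
  ∫ ω, inner ℝ (gradient (fun θ => network σ θ x) (double ω))
    (gradient (fun θ => network σ θ x') (double ω)) ∂(initLaw 𝒜 𝒲 ℬ ℬ' m d)

/-- The Gram matrix `H^∞_{ij} = K^∞(x_i, x_j)`. -/
def ntkGram (σ : ℝ → ℝ) (𝒜 𝒲 ℬ ℬ' : Measure ℝ) (m : ℕ) {d n : ℕ}
    (x : Fin n → EuclideanSpace ℝ (Fin d)) : Matrix (Fin n) (Fin n) ℝ :=
  Matrix.of fun i j => ntk σ 𝒜 𝒲 ℬ ℬ' m (x i) (x j)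

/-- The normalized Gram matrix `G^∞ = H^∞ / n`. -/
def ntkGramNormalized (σ : ℝ → ℝ) (𝒜 𝒲 ℬ ℬ' : Measure ℝ) (m : ℕ) {d n : ℕ}
    (x : Fin n → EuclideanSpace ℝ (Fin d)) : Matrix (Fin n) (Fin n) ℝ :=
  (1 / (n : ℝ)) • ntkGram σ 𝒜 𝒲 ℬ ℬ' m x

theorem ntkGram_isHermitian (σ : ℝ → ℝ) (𝒜 𝒲 ℬ ℬ' : Measure ℝ) (m : ℕ) {d n : ℕ}
    (x : Fin n → EuclideanSpace ℝ (Fin d)) : (ntkGram σ 𝒜 𝒲 ℬ ℬ' m x).IsHermitian := by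
  ext i j
  simp only [ntkGram, ntk, Matrix.conjTranspose_apply, Matrix.of_apply, star_trivial]
  congr 1
  funext ω
  exact real_inner_comm _ _

/-- `λ_n(H^∞)`, the smallest of the `n` eigenvalues of the symmetric matrix `H^∞`. -/
def lambdaMin (σ : ℝ → ℝ) (𝒜 𝒲 ℬ ℬ' : Measure ℝ) (m : ℕ) {d n : ℕ}
    (x : Fin n → EuclideanSpace ℝ (Fin d)) : ℝ :=
  ⨅ i, (ntkGram_isHermitian σ 𝒜 𝒲 ℬ ℬ' m x).eigenvalues i

/-- The logarithmic factor
`1 + log d + log n + log⁺(1/ε) + log⁺(1/lam) + log(1/δ)`, with `log⁺ = max(log, 0)`. -/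
def logFactor (d n : ℕ) (ε lam δ : ℝ) : ℝ :=
  1 + Real.log d + Real.log n + Real.posLog (1 / ε) + Real.posLog (1 / lam) + Real.log (1 / δ)

end ShallowNTK

end

/-!
# Wide shallow networks train like their tangent kernel

Along the gradient flow the residual solves `∂ₜ r = -(1/n) H(t) r`, where `H(t)` is the Gram
matrix of the parameter gradients of the network at the training inputs. The theorem holds because
`H(t)` stays close to the deterministic matrix `H^∞` for all times.

*At initialization.* A preactivation `⟨w, x⟩ + b` is subgaussian with a variance proxy that
depends on `‖x‖` but not on the dimension (`exists_hasSubgaussianMGF_preact`), so each neuron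
contributes to the kernel a subexponential variable with dimension-free scale
(`integrable_exp_abs_neuronKernel_div`). Bernstein's inequality and a union bound over the `n²`
entries and the `m` outer weights give an event on which `H(0)` is entrywise close to `H^∞` and
the outer weights are `O(√(log (m / δ)))` (`exists_initialization_event`).

*Along the flow.* The gradient of the network is a Lipschitz function of the parameters with
constant of order `√(log (m / δ) / m)`, globally and not only near initialization
(`norm_gradNetwork_sub_sq_le`): the increment of the outer weights enters only through a product
with the bounded `σ'`. While the gradients have moved little, `H(t)` keeps half of the spectral
gap `λ_n(H^∞)`, hence the residual decays exponentially, hence the parameters travel a bounded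
distance, hence the gradients have moved even less. This bootstrap closes for wide networks, and
Duhamel's principle in the form of a differential inequality compares `r` with `exp(-G^∞ t) r(0)`
(`norm_residual_sub_exp_le_of_lazy`).

*The constants.* The argument needs a width of order `n⁵ (L + log m) / (ε² λ_n⁴)`; the term
`log m` is absorbed by enlarging the constant (`mul_log_le_of_mul_le`), and the exponent `1` of
the logarithmic factor suffices. If `ε ≥ 2 B √n`, both trajectories lie in the ball of radius
`B √n`, because residuals never grow, and every width works (`norm_residual_sub_exp_le_of_le`);
otherwise `ε < 2 B √n` keeps the required precision of the Gram matrix below the range where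
Bernstein's inequality is subgaussian.

*Existence.* The flow exists for all times since the loss is `C²` and nonnegative: along the flow
it controls the distance travelled (`exists_gradientFlow`).
-/

noncomputable section

namespace ShallowNTK

open Set Filter Topology ProbabilityTheory

/-! ### Differential inequalities -/

/-- Grönwall's inequality with a negative rate and a source term: `u' ≤ -β (u - c)` implies
`u t ≤ c + (u 0 - c) exp (-β t)`. No sign of `β` or `u` is assumed. -/
theorem le_add_mul_exp_of_deriv_le {u u' : ℝ → ℝ} {β c T : ℝ}
    (hu : ∀ t, 0 ≤ t → HasDerivWithinAt u (u' t) (Ici 0) t)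
    (hle : ∀ t, 0 ≤ t → t ≤ T → u' t ≤ -β * (u t - c)) :
    ∀ t, 0 ≤ t → t ≤ T → u t ≤ c + (u 0 - c) * Real.exp (-β * t) := by
  intro t ht htT
  have hw : ∀ s, 0 ≤ s → HasDerivWithinAt (fun s => (u s - c) * Real.exp (β * s))
      (u' s * Real.exp (β * s) + (u s - c) * (Real.exp (β * s) * β)) (Ici 0) s := by
    intro s hs
    have h1 : HasDerivAt (fun s => Real.exp (β * s)) (Real.exp (β * s) * β) s := by
      simpa using ((hasDerivAt_id s).const_mul β).exp
    exact ((hu s hs).sub_const c).mul h1.hasDerivWithinAt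
  have hanti : AntitoneOn (fun s => (u s - c) * Real.exp (β * s)) (Icc 0 T) := by
    refine antitoneOn_of_hasDerivWithinAt_nonpos (convex_Icc 0 T)
      (f' := fun s => u' s * Real.exp (β * s) + (u s - c) * (Real.exp (β * s) * β)) ?_ ?_ ?_
    · intro s hs
      exact ((hw s hs.1).continuousWithinAt).mono Icc_subset_Ici_self
    · intro s hs
      exact (hw s (interior_subset hs).1).mono (interior_subset.trans Icc_subset_Ici_self)
    · intro s hs
      have := hle s (interior_subset hs).1 (interior_subset hs).2
      nlinarith [Real.exp_pos (β * s)]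
  have h0 := hanti (left_mem_Icc.2 (ht.trans htT)) ⟨ht, htT⟩ ht
  simp only [mul_zero, Real.exp_zero, mul_one] at h0
  have h2 : Real.exp (β * t) * Real.exp (-β * t) = 1 := by
    rw [← Real.exp_add]; simp
  have := mul_le_mul_of_nonneg_right h0 (Real.exp_pos (-β * t)).le
  rw [mul_assoc, h2] at this
  linarith

/-- A curve with exponentially decaying speed has finite length, uniformly in time. -/
theorem norm_sub_le_of_norm_deriv_le_exp {E : Type*} [NormedAddCommGroup E] [NormedSpace ℝ E]
    {γ γ' : ℝ → E} {β c T : ℝ} (hβ : 0 < β)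
    (hγ : ∀ t, 0 ≤ t → HasDerivWithinAt γ (γ' t) (Ici 0) t)
    (hle : ∀ t, 0 ≤ t → t ≤ T → ‖γ' t‖ ≤ c * Real.exp (-β * t)) :
    ∀ t, 0 ≤ t → t ≤ T → ‖γ t - γ 0‖ ≤ c / β := by
  intro t ht htT
  have hc : 0 ≤ c := by
    have := (norm_nonneg _).trans (hle 0 le_rfl (ht.trans htT))
    simpa using this
  have key := image_norm_le_of_norm_deriv_right_le_deriv_boundary (a := 0) (b := T)
    (f := fun s => γ s - γ 0) (f' := γ') (B := fun s => c / β * (1 - Real.exp (-β * s)))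
    (B' := fun s => c * Real.exp (-β * s)) ?_ ?_ ?_ ?_ ?_ (x := t) ⟨ht, htT⟩
  · refine key.trans ?_
    have : 0 ≤ c / β := by positivity
    nlinarith [Real.exp_pos (-β * t)]
  · intro s hs
    exact (((hγ s hs.1).sub_const _).continuousWithinAt).mono Icc_subset_Ici_self
  · intro s hs
    exact ((hγ s hs.1).sub_const _).mono (Ici_subset_Ici.2 hs.1)
  · simp
  · intro s
    have h1 : HasDerivAt (fun s => Real.exp (-β * s)) (Real.exp (-β * s) * (-β)) s := by
      simpa using ((hasDerivAt_id s).const_mul (-β)).exp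
    have := (h1.const_sub 1).const_mul (c / β)
    exact this.congr_deriv (by field_simp)
  · intro s hs
    exact hle s hs.1 hs.2.le

/-- Bootstrap: a continuous quantity that starts at `0` never leaves `[0, ρ]` if, as long as it has
not left, it is in fact at most `ρ / 2`. -/
theorem forall_le_of_forall_le_half {q : ℝ → ℝ} {ρ : ℝ} (hρ : 0 < ρ)
    (hq : ContinuousOn q (Ici 0)) (h0 : q 0 = 0)
    (hstep : ∀ T, 0 ≤ T → (∀ s, 0 ≤ s → s ≤ T → q s ≤ ρ) → q T ≤ ρ / 2) :
    ∀ t, 0 ≤ t → q t ≤ ρ := by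
  intro b hb
  have hsub : Icc 0 b ⊆ {t | ∀ s, 0 ≤ s → s ≤ t → q s ≤ ρ} := by
    refine IsClosed.Icc_subset_of_forall_exists_gt ?_ ?_ ?_
    · have : {t | ∀ s, 0 ≤ s → s ≤ t → q s ≤ ρ} ∩ Icc 0 b = {t ∈ Icc 0 b | q t ≤ ρ ∧
          ∀ s, 0 ≤ s → s < t → q s ≤ ρ} := by
        ext t
        constructor
        · rintro ⟨h, ht⟩
          exact ⟨ht, h t ht.1 le_rfl, fun s hs hst => h s hs hst.le⟩
        · rintro ⟨ht, h1, h2⟩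
          refine ⟨fun s hs hst => ?_, ht⟩
          rcases hst.eq_or_lt with rfl | h
          · exact h1
          · exact h2 s hs h
      rw [this]
      have hc : {t ∈ Icc 0 b | q t ≤ ρ ∧ ∀ s, 0 ≤ s → s < t → q s ≤ ρ} =
          (Icc 0 b ∩ q ⁻¹' Iic ρ) ∩ {t | ∀ s, 0 ≤ s → s < t → q s ≤ ρ} := by
        ext t; simp [and_assoc]
      rw [hc]
      refine IsClosed.inter ?_ ?_
      · exact (hq.mono Icc_subset_Ici_self).preimage_isClosed_of_isClosed isClosed_Icc isClosed_Iic
      · have : {t | ∀ s, 0 ≤ s → s < t → q s ≤ ρ} = ⋂ s, {t | 0 ≤ s → s < t → q s ≤ ρ} := by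
          ext; simp
        rw [this]
        refine isClosed_iInter fun s => ?_
        by_cases hs : 0 ≤ s → q s ≤ ρ
        · convert isClosed_univ
          ext t; simp; tauto
        · push Not at hs
          convert isClosed_Iic (a := s)
          ext t; simp [hs.1, hs.2.not_ge]
    · intro s hs hs'
      have : s = 0 := le_antisymm hs' hs
      rw [this, h0]; exact hρ.le
    · rintro t ⟨ht, ht0, htb⟩ y hy
      have hlt : q t < ρ := lt_of_le_of_lt (hstep t ht0 ht) (by linarith)
      have hev : ∀ᶠ s in 𝓝[Ici 0] t, q s < ρ :=
        (hq t ht0).eventually (Iio_mem_nhds hlt)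
      rw [eventually_nhdsWithin_iff, Metric.eventually_nhds_iff] at hev
      obtain ⟨e, he, hev⟩ := hev
      have hmin : 0 < min (e / 2) (y - t) := lt_min (by linarith) (sub_pos.2 hy)
      refine ⟨t + min (e / 2) (y - t), ?_, ?_, ?_⟩
      · intro s hs hst
        rcases le_or_gt s t with h | h
        · exact ht s hs h
        · refine (hev ?_ hs).le
          rw [Real.dist_eq, abs_of_pos (by linarith)]
          have := min_le_left (e / 2) (y - t)
          linarith
      · exact lt_add_of_pos_right t hmin
      · have := min_le_right (e / 2) (y - t)
        linarith
  exact hsub ⟨hb, le_rfl⟩ b hb le_rfl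

/-! ### Existence of the gradient flow -/

theorem contDiff_gradient {E : Type*} [NormedAddCommGroup E] [InnerProductSpace ℝ E]
    [CompleteSpace E] {Φ : E → ℝ} (hΦ : ContDiff ℝ 2 Φ) : ContDiff ℝ 1 (gradient Φ) := by
  have h : ContDiff ℝ 1 (fderiv ℝ Φ) := hΦ.fderiv_right (by norm_num)
  exact (InnerProductSpace.toDual ℝ E).symm.contDiff.comp h

/-- On a finite time interval the gradient flow of a nonnegative `C²` function exists and stays in
an explicit ball. The gradient is cut off outside a larger ball, which makes the field globally
Lipschitz. The loss also decreases along the truncated flow and controls its length through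
`‖χ ∇Φ‖ ≤ (1 + χ ‖∇Φ‖²) / 2`, so the flow never reaches the region where the cutoff acts. -/
theorem exists_gradientFlow_Icc {E : Type*} [NormedAddCommGroup E] [InnerProductSpace ℝ E]
    [FiniteDimensional ℝ E] [CompleteSpace E] {Φ : E → ℝ} (hΦ : ContDiff ℝ 2 Φ)
    (hpos : ∀ x, 0 ≤ Φ x) (x₀ : E) {T : ℝ} (hT : 0 ≤ T) :
    ∃ α : ℝ → E, α 0 = x₀ ∧ ∀ t ∈ Icc 0 T, HasDerivWithinAt α (-gradient Φ (α t)) (Icc 0 T) t ∧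
      α t ∈ Metric.closedBall x₀ ((T + Φ x₀) / 2) := by
  have hR : 0 ≤ (T + Φ x₀) / 2 := by have := hpos x₀; positivity
  let χ : ContDiffBump x₀ := ⟨(T + Φ x₀) / 2 + 1, (T + Φ x₀) / 2 + 2, by linarith, by linarith⟩
  let v : E → E := fun x => χ x • -gradient Φ x
  have hv1 : ContDiff ℝ 1 v := χ.contDiff.smul (contDiff_gradient hΦ).neg
  have hvc : HasCompactSupport v := χ.hasCompactSupport.smul_right
  obtain ⟨K, hK⟩ := hv1.lipschitzWith_of_hasCompactSupport hvc one_ne_zero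
  obtain ⟨L, hL⟩ := hvc.exists_bound_of_continuous hv1.continuous
  have hL0 : 0 ≤ L := (norm_nonneg _).trans (hL x₀)
  have hPL : IsPicardLindelof (fun _ => v) (⟨0, left_mem_Icc.2 hT⟩ : Icc 0 T) x₀
      ⟨L * T, by positivity⟩ 0 ⟨L, hL0⟩ K := by
    refine IsPicardLindelof.of_time_independent (fun x _ => hL x) (hK.lipschitzOnWith) ?_
    simp only [sub_zero, sub_self, max_eq_left hT, NNReal.coe_zero]
    exact le_rfl
  obtain ⟨α, hα0, hα⟩ := hPL.exists_eq_forall_mem_Icc_hasDerivWithinAt₀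
  change α 0 = x₀ at hα0
  have hdiff : Differentiable ℝ Φ := hΦ.differentiable (by norm_num)
  -- along the truncated field the loss still controls the displacement
  have hball : ∀ t ∈ Icc 0 T, α t ∈ Metric.closedBall x₀ ((T + Φ x₀) / 2) := by
    intro t ht
    have hB : ∀ s ∈ Icc 0 T, HasDerivWithinAt (fun s => (s + Φ x₀ - Φ (α s)) / 2)
        ((1 + χ (α s) * ‖gradient Φ (α s)‖ ^ 2) / 2) (Icc 0 T) s := by
      intro s hs
      have h1 := (hdiff (α s)).hasGradientAt.hasFDerivAt.comp_hasDerivWithinAt s (hα s hs)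
      have h2 := ((((hasDerivWithinAt_id s (Icc 0 T)).add_const (Φ x₀)).sub h1).div_const 2)
      refine h2.congr_deriv ?_
      simp only [v, InnerProductSpace.toDual_apply_apply, real_inner_smul_right, inner_neg_right,
        real_inner_self_eq_norm_sq]
      ring
    have key := image_norm_le_of_norm_deriv_right_le_deriv_boundary' (a := 0) (b := T)
      (f := fun s => α s - x₀) (f' := fun s => v (α s))
      (B := fun s => (s + Φ x₀ - Φ (α s)) / 2)
      (B' := fun s => (1 + χ (α s) * ‖gradient Φ (α s)‖ ^ 2) / 2) ?_ ?_ ?_ ?_ ?_ ?_ ht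
    · rw [mem_closedBall_iff_norm]
      refine key.trans ?_
      have := hpos (α t)
      have := ht.2
      linarith
    · exact fun s hs => ((hα s hs).sub_const _).continuousWithinAt
    · intro s hs
      exact ((hα s ⟨hs.1, hs.2.le⟩).sub_const _).mono_of_mem_nhdsWithin
        (Icc_mem_nhdsGE_of_mem hs)
    · simp [hα0]
    · exact fun s hs => (hB s hs).continuousWithinAt
    · intro s hs
      exact (hB s ⟨hs.1, hs.2.le⟩).mono_of_mem_nhdsWithin (Icc_mem_nhdsGE_of_mem hs)
    · intro s hs
      have h0 := χ.nonneg (x := α s)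
      have h1 := χ.le_one (x := α s)
      simp only [v, norm_smul, norm_neg, Real.norm_eq_abs, abs_of_nonneg h0]
      nlinarith [sq_nonneg (‖gradient Φ (α s)‖ - 1), norm_nonneg (gradient Φ (α s))]
  refine ⟨α, hα0, fun t ht => ⟨?_, hball t ht⟩⟩
  have h1 : χ (α t) = 1 := χ.one_of_mem_closedBall
    (Metric.closedBall_subset_closedBall (by simp only [χ]; linarith) (hball t ht))
  simpa [v, h1] using hα t ht

/-- Global existence of the gradient flow of a nonnegative `C²` function: the solutions on the
intervals `[0, k + 1]` agree where they overlap, and are glued at time `t` by the index `⌊t⌋₊`. -/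
theorem exists_gradientFlow {E : Type*} [NormedAddCommGroup E] [InnerProductSpace ℝ E]
    [FiniteDimensional ℝ E] [CompleteSpace E] {Φ : E → ℝ} (hΦ : ContDiff ℝ 2 Φ)
    (hpos : ∀ x, 0 ≤ Φ x) (x₀ : E) :
    ∃ θ : ℝ → E, θ 0 = x₀ ∧
      ∀ t, 0 ≤ t → HasDerivWithinAt θ (-gradient Φ (θ t)) (Ici 0) t := by
  have hex : ∀ n : ℕ, ∃ α : ℝ → E, α 0 = x₀ ∧ ∀ t ∈ Icc 0 (n + 1 : ℝ),
      HasDerivWithinAt α (-gradient Φ (α t)) (Icc 0 (n + 1 : ℝ)) t ∧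
      α t ∈ Metric.closedBall x₀ ((n + 1 + Φ x₀) / 2) := fun n =>
    exists_gradientFlow_Icc hΦ hpos x₀ (by positivity)
  choose α hα0 hα using hex
  have huniq : ∀ n k : ℕ, n ≤ k → EqOn (α n) (α k) (Icc 0 (n + 1 : ℝ)) := by
    intro n k hnk
    have hnk' : (n : ℝ) ≤ k := by exact_mod_cast hnk
    obtain ⟨K, hK⟩ := (contDiff_gradient hΦ).neg.contDiffOn.exists_lipschitzOnWith one_ne_zero
      (convex_closedBall x₀ ((k + 1 + Φ x₀) / 2)) (isCompact_closedBall x₀ _)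
    have hsub : Icc 0 (n + 1 : ℝ) ⊆ Icc 0 (k + 1 : ℝ) := Icc_subset_Icc_right (by linarith)
    refine ODE_solution_unique_of_mem_Icc_right (v := fun _ x => -gradient Φ x)
      (s := fun _ => Metric.closedBall x₀ ((k + 1 + Φ x₀) / 2)) (K := K) (fun _ _ => hK)
      ?_ ?_ ?_ ?_ ?_ ?_ ((hα0 n).trans (hα0 k).symm)
    · exact fun s hs => (hα n s hs).1.continuousWithinAt
    · intro s hs
      exact (hα n s ⟨hs.1, hs.2.le⟩).1.mono_of_mem_nhdsWithin (Icc_mem_nhdsGE_of_mem hs)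
    · intro s hs
      exact Metric.closedBall_subset_closedBall (by linarith) (hα n s ⟨hs.1, hs.2.le⟩).2
    · exact fun s hs => (hα k s (hsub hs)).1.continuousWithinAt.mono hsub
    · intro s hs
      exact (hα k s ⟨hs.1, by linarith [hs.2]⟩).1.mono_of_mem_nhdsWithin
        (Icc_mem_nhdsGE_of_mem ⟨hs.1, by linarith [hs.2]⟩)
    · intro s hs
      exact (hα k s ⟨hs.1, by linarith [hs.2]⟩).2
  have hglue : ∀ n : ℕ, EqOn (fun t => α ⌊t⌋₊ t) (α n) (Icc 0 (n + 1 : ℝ)) := by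
    intro n t ht
    rcases le_total ⌊t⌋₊ n with h | h
    · exact huniq _ _ h ⟨ht.1, (Nat.lt_floor_add_one t).le⟩
    · exact (huniq _ _ h ht).symm
  refine ⟨fun t => α ⌊t⌋₊ t, by simpa using hα0 0, fun t ht => ?_⟩
  have htn : t < (⌊t⌋₊ : ℝ) + 1 := Nat.lt_floor_add_one t
  have h1 := (hα ⌊t⌋₊ t ⟨ht, htn.le⟩).1.congr (hglue ⌊t⌋₊) rfl
  refine h1.mono_of_mem_nhdsWithin ?_
  rw [← Ici_inter_Iic]
  exact inter_mem self_mem_nhdsWithin (mem_nhdsWithin_of_mem_nhds (Iic_mem_nhds htn))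

/-! ### Gradient and feature map of the network -/

/-- The preactivation `⟨w_ℓ, x⟩ + b_ℓ` of neuron `ℓ`. -/
def preact {ι : Type} {d : ℕ} (θ : Param ι d) (x : EuclideanSpace ℝ (Fin d)) (ℓ : ι) : ℝ :=
  ∑ j, weight θ ℓ j * x j + bias θ ℓ

/-- The gradient of `θ ↦ f(x; θ)` in closed form. -/
def gradNetwork {ι : Type} [Fintype ι] {d : ℕ} (σ : ℝ → ℝ) (θ : Param ι d)
    (x : EuclideanSpace ℝ (Fin d)) : Param ι d :=
  WithLp.toLp 2 fun
    | Sum.inl ℓ => 1 / √(Fintype.card ι : ℝ) * σ (preact θ x ℓ)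
    | Sum.inr (Sum.inl (ℓ, j)) =>
        1 / √(Fintype.card ι : ℝ) * (outer θ ℓ * deriv σ (preact θ x ℓ)) * x j
    | Sum.inr (Sum.inr (Sum.inl ℓ)) =>
        1 / √(Fintype.card ι : ℝ) * (outer θ ℓ * deriv σ (preact θ x ℓ))
    | Sum.inr (Sum.inr (Sum.inr _)) => 1

/-- Preactivations are Lipschitz in the parameters of their own neuron, by Cauchy–Schwarz. -/
theorem preact_sub_sq_le {ι : Type} {d : ℕ} (θ θ' : Param ι d) (x : EuclideanSpace ℝ (Fin d))
    (ℓ : ι) :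
    (preact θ x ℓ - preact θ' x ℓ) ^ 2 ≤
      (‖x‖ ^ 2 + 1) * ((∑ j, weight (θ - θ') ℓ j ^ 2) + bias (θ - θ') ℓ ^ 2) := by
  have h1 : preact θ x ℓ - preact θ' x ℓ =
      (∑ j, weight (θ - θ') ℓ j * x j) + bias (θ - θ') ℓ := by
    simp only [preact, weight, bias, PiLp.sub_apply, sub_mul, Finset.sum_sub_distrib]
    ring
  have h2 := Finset.sum_mul_sq_le_sq_mul_sq Finset.univ (fun j => weight (θ - θ') ℓ j)
    (fun j => x j)
  have h3 : ‖x‖ ^ 2 = ∑ j, x j ^ 2 := by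
    rw [EuclideanSpace.norm_sq_eq]; simp
  rw [h1, h3]
  set S := ∑ j, weight (θ - θ') ℓ j * x j
  set U := ∑ j, weight (θ - θ') ℓ j ^ 2
  set b := bias (θ - θ') ℓ
  set X := ∑ j, x j ^ 2
  have hU : 0 ≤ U := Finset.sum_nonneg fun _ _ => sq_nonneg _
  have hX : 0 ≤ X := Finset.sum_nonneg fun _ _ => sq_nonneg _
  have h4 : 2 * S * b ≤ U + X * b ^ 2 := by
    have : (2 * S * b) ^ 2 ≤ (U + X * b ^ 2) ^ 2 := by
      nlinarith [sq_nonneg (U - X * b ^ 2), sq_nonneg b]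
    exact le_of_sq_le_sq this (by positivity)
  nlinarith

section Calculus

variable {ι : Type} [Fintype ι] {d : ℕ}

theorem inner_param (u v : Param ι d) :
    inner ℝ u v = ∑ ℓ, (outer u ℓ * outer v ℓ + (∑ j, weight u ℓ j * weight v ℓ j) +
      bias u ℓ * bias v ℓ) + outerBias u * outerBias v := by
  simp only [PiLp.inner_apply, Fintype.sum_sum_type, Fintype.sum_prod_type, RCLike.inner_apply,
    conj_trivial, Finset.sum_add_distrib, outer, weight, bias, outerBias, Finset.univ_unique,
    Finset.sum_singleton, PUnit.default_eq_unit]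
  simp only [mul_comm (u _)]
  ring

theorem norm_sq_param (u : Param ι d) :
    ‖u‖ ^ 2 = ∑ ℓ, (outer u ℓ ^ 2 + (∑ j, weight u ℓ j ^ 2) + bias u ℓ ^ 2) +
      outerBias u ^ 2 := by
  rw [← real_inner_self_eq_norm_sq, inner_param]
  simp only [pow_two]

theorem hasGradientAt_network {σ : ℝ → ℝ} (hσ : Differentiable ℝ σ) (θ : Param ι d)
    (x : EuclideanSpace ℝ (Fin d)) :
    HasGradientAt (fun θ => network σ θ x) (gradNetwork σ θ x) θ := by
  rw [hasGradientAt_iff_hasFDerivAt]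
  have hcoord : ∀ i : ParamIdx ι d, HasFDerivAt (fun θ : Param ι d => θ i)
      (EuclideanSpace.proj i : Param ι d →L[ℝ] ℝ) θ := fun i =>
    (EuclideanSpace.proj i : Param ι d →L[ℝ] ℝ).hasFDerivAt
  have hz : ∀ ℓ, HasFDerivAt (fun θ : Param ι d => ∑ j, weight θ ℓ j * x j + bias θ ℓ)
      ((∑ j, x j • (EuclideanSpace.proj (Sum.inr (Sum.inl (ℓ, j))) : Param ι d →L[ℝ] ℝ)) +
        (EuclideanSpace.proj (Sum.inr (Sum.inr (Sum.inl ℓ))) : Param ι d →L[ℝ] ℝ)) θ := by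
    intro ℓ
    refine HasFDerivAt.add (HasFDerivAt.fun_sum fun j _ => ?_) (hcoord _)
    exact (hcoord _).mul_const (x j)
  have hn : HasFDerivAt (fun θ : Param ι d => network σ θ x) _ θ :=
    ((HasFDerivAt.fun_sum (u := Finset.univ) fun ℓ _ => (hcoord (Sum.inl ℓ)).mul
      ((hσ _).hasDerivAt.comp_hasFDerivAt θ (hz ℓ))).const_mul
        (1 / √(Fintype.card ι : ℝ))).add (hcoord (Sum.inr (Sum.inr (Sum.inr ()))))
  refine hn.congr_fderiv ?_
  ext v
  simp only [InnerProductSpace.toDual_apply_apply, inner_param]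
  simp [gradNetwork, outer, weight, bias, outerBias, preact, Finset.mul_sum, Finset.sum_add_distrib]
  simp only [← Finset.sum_add_distrib]
  refine Finset.sum_congr rfl fun ℓ _ => ?_
  have : ∀ a b c : ℝ, a + b + c = c + a + b := fun _ _ _ => by ring
  rw [this]
  refine congrArg₂ _ (congrArg₂ _ ?_ (Finset.sum_congr rfl fun j _ => ?_)) ?_ <;> ring

theorem contDiff_network {σ : ℝ → ℝ} (hσ : ContDiff ℝ 2 σ) (x : EuclideanSpace ℝ (Fin d)) :
    ContDiff ℝ 2 (fun θ : Param ι d => network σ θ x) := by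
  have hcoord : ∀ i : ParamIdx ι d, ContDiff ℝ 2 (fun θ : Param ι d => θ i) := fun i =>
    (EuclideanSpace.proj i : Param ι d →L[ℝ] ℝ).contDiff
  unfold network outer weight bias outerBias
  have hz : ∀ ℓ, ContDiff ℝ 2 fun θ : Param ι d => σ (∑ j, θ (Sum.inr (Sum.inl (ℓ, j))) * x j +
      θ (Sum.inr (Sum.inr (Sum.inl ℓ)))) := fun ℓ =>
    hσ.comp ((ContDiff.sum fun j _ =>
      (hcoord (Sum.inr (Sum.inl (ℓ, j)))).mul contDiff_const).add (hcoord _))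
  exact (contDiff_const.mul (ContDiff.sum fun ℓ _ => (hcoord (Sum.inl ℓ)).mul (hz ℓ))).add
    (hcoord _)

theorem inner_gradNetwork (σ : ℝ → ℝ) (θ : Param ι d) (x x' : EuclideanSpace ℝ (Fin d)) :
    inner ℝ (gradNetwork σ θ x) (gradNetwork σ θ x') =
      1 / (Fintype.card ι : ℝ) * ∑ ℓ, (σ (preact θ x ℓ) * σ (preact θ x' ℓ) +
        outer θ ℓ ^ 2 * (deriv σ (preact θ x ℓ) * deriv σ (preact θ x' ℓ)) *
          (inner ℝ x x' + 1)) + 1 := by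
  have hN : 1 / √(Fintype.card ι : ℝ) * (1 / √(Fintype.card ι : ℝ)) = 1 / (Fintype.card ι : ℝ) := by
    rw [div_mul_div_comm, one_mul, Real.mul_self_sqrt (Nat.cast_nonneg _)]
  rw [inner_param, Finset.mul_sum]
  congr 1
  · refine Finset.sum_congr rfl fun ℓ _ => ?_
    rw [← hN]
    have hx : (inner ℝ x x' : ℝ) = ∑ j, x j * x' j := by
      simp [PiLp.inner_apply, mul_comm]
    rw [hx]
    simp only [gradNetwork, outer, weight, bias]
    have : ∀ c e : ℝ, ∑ j, c * x j * (e * x' j) = c * e * ∑ j, x j * x' j := by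
      intro c e
      rw [Finset.mul_sum]
      exact Finset.sum_congr rfl fun j _ => by ring
    rw [this]
    ring
  · simp [outerBias, gradNetwork]

/-- The feature map `θ ↦ ∂f(x; θ)` satisfies a global Lipschitz estimate around `θ₀`, of order
`N^{-1/2}` up to the size `T` of the outer weights of `θ₀`. No bound on the outer weights of `θ` is
needed: in `a σ'(z) - a₀ σ'(z₀) = (a - a₀) σ'(z) + a₀ (σ'(z) - σ'(z₀))` the increment of the outer
weight multiplies only the bounded `σ'`. -/
theorem norm_gradNetwork_sub_sq_le {σ : ℝ → ℝ} {s₁ s₂ M T : ℝ} (hσ : ContDiff ℝ 2 σ)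
    (h1 : ∀ z, |deriv σ z| ≤ s₁) (h2 : ∀ z, |deriv (deriv σ) z| ≤ s₂)
    {θ θ₀ : Param ι d} (hT : ∀ ℓ, |outer θ₀ ℓ| ≤ T) {x : EuclideanSpace ℝ (Fin d)}
    (hx : ‖x‖ ≤ M) :
    ‖gradNetwork σ θ x - gradNetwork σ θ₀ x‖ ^ 2 ≤
      (3 * (M ^ 2 + 1) * s₁ ^ 2 + 2 * (M ^ 2 + 1) ^ 2 * s₂ ^ 2) * (1 + T ^ 2) /
        (Fintype.card ι : ℝ) * ‖θ - θ₀‖ ^ 2 := by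
  have hlip : ∀ {f : ℝ → ℝ} {c : ℝ}, Differentiable ℝ f → (∀ z, |deriv f z| ≤ c) → ∀ u v,
      (f u - f v) ^ 2 ≤ c ^ 2 * (u - v) ^ 2 := by
    intro f c hf hc u v
    have := convex_univ.norm_image_sub_le_of_norm_deriv_le (fun z _ => hf z)
      (fun z _ => hc z) (mem_univ v) (mem_univ u)
    rw [Real.norm_eq_abs, Real.norm_eq_abs] at this
    have h3 := pow_le_pow_left₀ (abs_nonneg _) this 2
    rwa [mul_pow, sq_abs, sq_abs] at h3
  have hd1 : Differentiable ℝ σ := hσ.differentiable (by norm_num)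
  have hd2 : Differentiable ℝ (deriv σ) :=
    hσ.differentiable_deriv_two
  have hN : (1 / √(Fintype.card ι : ℝ)) ^ 2 = 1 / (Fintype.card ι : ℝ) := by
    rw [div_pow, one_pow, Real.sq_sqrt (Nat.cast_nonneg _)]
  have hxs : ‖x‖ ^ 2 ≤ M ^ 2 := pow_le_pow_left₀ (norm_nonneg _) hx 2
  have hxe : ‖x‖ ^ 2 = ∑ j, x j ^ 2 := by
    rw [EuclideanSpace.norm_sq_eq]; simp
  rw [norm_sq_param, norm_sq_param]
  have h0 : outerBias (gradNetwork σ θ x - gradNetwork σ θ₀ x) = 0 := by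
    simp [outerBias, gradNetwork]
  rw [h0]
  set Q := M ^ 2 + 1
  have hQ : 1 ≤ Q := by simp only [Q]; nlinarith [sq_nonneg M]
  set c := 3 * Q * s₁ ^ 2 + 2 * Q ^ 2 * s₂ ^ 2
  have hcN : 0 ≤ c * (1 + T ^ 2) / (Fintype.card ι : ℝ) := by positivity
  have hsum : ∑ ℓ, (outer (gradNetwork σ θ x - gradNetwork σ θ₀ x) ℓ ^ 2 +
      (∑ j, weight (gradNetwork σ θ x - gradNetwork σ θ₀ x) ℓ j ^ 2) +
        bias (gradNetwork σ θ x - gradNetwork σ θ₀ x) ℓ ^ 2) ≤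
      ∑ ℓ, c * (1 + T ^ 2) / (Fintype.card ι : ℝ) * (outer (θ - θ₀) ℓ ^ 2 +
        (∑ j, weight (θ - θ₀) ℓ j ^ 2) + bias (θ - θ₀) ℓ ^ 2) := by
    refine Finset.sum_le_sum fun ℓ _ => ?_
    set z := preact θ x ℓ
    set z₀ := preact θ₀ x ℓ
    set U := (∑ j, weight (θ - θ₀) ℓ j ^ 2) + bias (θ - θ₀) ℓ ^ 2
    have hU0 : 0 ≤ U := by positivity
    have hzU : (z - z₀) ^ 2 ≤ Q * U := (preact_sub_sq_le θ θ₀ x ℓ).trans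
      (mul_le_mul_of_nonneg_right (by simp only [Q]; linarith) hU0)
    set D := outer θ ℓ * deriv σ z - outer θ₀ ℓ * deriv σ z₀
    have hD : D ^ 2 ≤ 2 * s₁ ^ 2 * outer (θ - θ₀) ℓ ^ 2 + 2 * T ^ 2 * (s₂ ^ 2 * (Q * U)) := by
      have e : D = outer (θ - θ₀) ℓ * deriv σ z + outer θ₀ ℓ * (deriv σ z - deriv σ z₀) := by
        simp only [D, outer, PiLp.sub_apply]; ring
      have e1 : (outer (θ - θ₀) ℓ * deriv σ z) ^ 2 ≤ s₁ ^ 2 * outer (θ - θ₀) ℓ ^ 2 := by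
        rw [mul_pow, mul_comm]
        exact mul_le_mul_of_nonneg_right (sq_le_sq' (abs_le.1 (h1 z)).1 (abs_le.1 (h1 z)).2)
          (sq_nonneg _)
      have e2 : (outer θ₀ ℓ * (deriv σ z - deriv σ z₀)) ^ 2 ≤ T ^ 2 * (s₂ ^ 2 * (Q * U)) := by
        rw [mul_pow]
        refine mul_le_mul (sq_le_sq' (abs_le.1 (hT ℓ)).1 (abs_le.1 (hT ℓ)).2)
          ((hlip hd2 h2 z z₀).trans ?_) (sq_nonneg _) (sq_nonneg _)
        exact mul_le_mul_of_nonneg_left hzU (sq_nonneg _)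
      rw [e]
      nlinarith [sq_nonneg (outer (θ - θ₀) ℓ * deriv σ z -
        outer θ₀ ℓ * (deriv σ z - deriv σ z₀))]
    have hS : (σ z - σ z₀) ^ 2 ≤ s₁ ^ 2 * (Q * U) := (hlip hd1 h1 z z₀).trans
      (mul_le_mul_of_nonneg_left hzU (sq_nonneg _))
    have hL : outer (gradNetwork σ θ x - gradNetwork σ θ₀ x) ℓ ^ 2 +
        (∑ j, weight (gradNetwork σ θ x - gradNetwork σ θ₀ x) ℓ j ^ 2) +
          bias (gradNetwork σ θ x - gradNetwork σ θ₀ x) ℓ ^ 2 =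
        1 / (Fintype.card ι : ℝ) * ((σ z - σ z₀) ^ 2 + (‖x‖ ^ 2 + 1) * D ^ 2) := by
      rw [hxe, ← hN]
      simp only [outer, weight, bias, gradNetwork, PiLp.sub_apply, ← mul_sub, ← sub_mul, mul_pow,
        ← Finset.mul_sum]
      simp only [D, z, z₀, outer]
      ring
    have hR : c * (1 + T ^ 2) / (Fintype.card ι : ℝ) * (outer (θ - θ₀) ℓ ^ 2 +
        (∑ j, weight (θ - θ₀) ℓ j ^ 2) + bias (θ - θ₀) ℓ ^ 2) =
        1 / (Fintype.card ι : ℝ) * (c * (1 + T ^ 2) * (outer (θ - θ₀) ℓ ^ 2 + U)) := by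
      simp only [U]; ring
    rw [hL, hR]
    refine mul_le_mul_of_nonneg_left ?_ (by positivity)
    set A := outer (θ - θ₀) ℓ ^ 2
    have hA : 0 ≤ A := sq_nonneg _
    have e1 : (‖x‖ ^ 2 + 1) * D ^ 2 ≤ Q * D ^ 2 :=
      mul_le_mul_of_nonneg_right (by simp only [Q]; linarith) (sq_nonneg _)
    have e2 : Q * D ^ 2 ≤ Q * (2 * s₁ ^ 2 * A + 2 * T ^ 2 * (s₂ ^ 2 * (Q * U))) :=
      mul_le_mul_of_nonneg_left hD (by linarith)
    have e3 : c * (1 + T ^ 2) * (A + U) - (s₁ ^ 2 * (Q * U) +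
        Q * (2 * s₁ ^ 2 * A + 2 * T ^ 2 * (s₂ ^ 2 * (Q * U)))) =
        2 * Q * s₁ ^ 2 * U + Q * s₁ ^ 2 * A + 3 * Q * s₁ ^ 2 * T ^ 2 * (A + U) +
          2 * Q ^ 2 * s₂ ^ 2 * (A + U) + 2 * Q ^ 2 * s₂ ^ 2 * T ^ 2 * A := by
      simp only [c]; ring
    have e4 : 0 ≤ 2 * Q * s₁ ^ 2 * U + Q * s₁ ^ 2 * A + 3 * Q * s₁ ^ 2 * T ^ 2 * (A + U) +
          2 * Q ^ 2 * s₂ ^ 2 * (A + U) + 2 * Q ^ 2 * s₂ ^ 2 * T ^ 2 * A := by positivity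
    linarith
  rw [← Finset.mul_sum] at hsum
  have hb : 0 ≤ outerBias (θ - θ₀) ^ 2 := sq_nonneg _
  nlinarith

end Calculus

/-! ### Symmetric matrices and their exponentials -/

section MatrixExponential
open scoped Matrix.Norms.Operator

theorem exp_mulVec_of_eigenvector {n : ℕ} {A : Matrix (Fin n) (Fin n) ℝ} {v : Fin n → ℝ} {c : ℝ}
    (h : A *ᵥ v = c • v) : NormedSpace.exp A *ᵥ v = Real.exp c • v := by
  have hpow : ∀ k : ℕ, (A ^ k) *ᵥ v = c ^ k • v := by
    intro k
    induction k with
    | zero => simp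
    | succ k ih => rw [pow_succ, ← Matrix.mulVec_mulVec, h, Matrix.mulVec_smul, ih, smul_smul,
        pow_succ, mul_comm]
  have h1 := NormedSpace.exp_series_hasSum_exp' (𝕂 := ℝ) A
  have h2 := h1.map (Matrix.mulVecBilin ℝ ℝ |>.flip v) (by
    exact LinearMap.continuous_of_finiteDimensional _)
  have h3 := (NormedSpace.exp_series_hasSum_exp' (𝕂 := ℝ) c).smul_const v
  rw [← Real.exp_eq_exp_ℝ] at h3
  refine h2.unique ?_
  convert h3 using 2 with k
  simp [hpow, smul_smul]

end MatrixExponential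

section Spectral

variable {n : ℕ} {A : Matrix (Fin n) (Fin n) ℝ}
  (b : OrthonormalBasis (Fin n) ℝ (EuclideanSpace ℝ (Fin n))) {lam : Fin n → ℝ}

theorem mulVec_eq_sum_eigenbasis (hb : ∀ i, A *ᵥ WithLp.ofLp (b i) = lam i • WithLp.ofLp (b i))
    (w : EuclideanSpace ℝ (Fin n)) :
    WithLp.toLp 2 (A *ᵥ WithLp.ofLp w) = ∑ i, (lam i * inner ℝ (b i) w) • b i := by
  conv_lhs => rw [← b.sum_repr' w]
  ext k
  simp only [WithLp.ofLp_sum, WithLp.ofLp_smul, Matrix.mulVec_sum, Matrix.mulVec_smul, hb]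
  simp [mul_comm, mul_left_comm, mul_assoc]

theorem norm_sq_sum_smul_basis (c : Fin n → ℝ) : ‖∑ i, c i • b i‖ ^ 2 = ∑ i, c i ^ 2 := by
  rw [← real_inner_self_eq_norm_sq, b.orthonormal.inner_sum]
  simp [pow_two]

theorem inner_mulVec_ge (hb : ∀ i, A *ᵥ WithLp.ofLp (b i) = lam i • WithLp.ofLp (b i)) {l : ℝ}
    (hl : ∀ i, l ≤ lam i) (w : EuclideanSpace ℝ (Fin n)) :
    l * ‖w‖ ^ 2 ≤ inner ℝ w (WithLp.toLp 2 (A *ᵥ WithLp.ofLp w)) := by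
  rw [mulVec_eq_sum_eigenbasis b hb, inner_sum, ← b.sum_sq_norm_inner_right w, Finset.mul_sum]
  refine Finset.sum_le_sum fun i _ => ?_
  rw [real_inner_smul_right, real_inner_comm (b i) w, Real.norm_eq_abs, sq_abs, mul_assoc,
    ← pow_two]
  exact mul_le_mul_of_nonneg_right (hl i) (sq_nonneg _)

theorem exp_neg_smul_mulVec (hb : ∀ i, A *ᵥ WithLp.ofLp (b i) = lam i • WithLp.ofLp (b i)) (t : ℝ)
    (w : EuclideanSpace ℝ (Fin n)) :
    WithLp.toLp 2 (NormedSpace.exp (-(t • A)) *ᵥ WithLp.ofLp w) =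
      ∑ i, (Real.exp (-(t * lam i)) * inner ℝ (b i) w) • b i := by
  refine mulVec_eq_sum_eigenbasis b (fun i => exp_mulVec_of_eigenvector ?_) w
  rw [Matrix.neg_mulVec, Matrix.smul_mulVec, hb, smul_smul, neg_smul]

theorem norm_sq_exp_neg_smul_mulVec
    (hb : ∀ i, A *ᵥ WithLp.ofLp (b i) = lam i • WithLp.ofLp (b i)) (t : ℝ)
    (w : EuclideanSpace ℝ (Fin n)) :
    ‖WithLp.toLp 2 (NormedSpace.exp (-(t • A)) *ᵥ WithLp.ofLp w)‖ ^ 2 =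
      ∑ i, Real.exp (-2 * lam i * t) * |inner ℝ w (b i)| ^ 2 := by
  rw [exp_neg_smul_mulVec b hb, norm_sq_sum_smul_basis]
  refine Finset.sum_congr rfl fun i _ => ?_
  rw [mul_pow, real_inner_comm, sq_abs, ← Real.exp_nat_mul]
  congr 2
  push_cast; ring

theorem norm_exp_neg_smul_mulVec_le
    (hb : ∀ i, A *ᵥ WithLp.ofLp (b i) = lam i • WithLp.ofLp (b i)) (hl : ∀ i, 0 ≤ lam i) {t : ℝ}
    (ht : 0 ≤ t) (w : EuclideanSpace ℝ (Fin n)) :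
    ‖WithLp.toLp 2 (NormedSpace.exp (-(t • A)) *ᵥ WithLp.ofLp w)‖ ≤ ‖w‖ := by
  refine le_of_sq_le_sq ?_ (norm_nonneg _)
  rw [norm_sq_exp_neg_smul_mulVec b hb, ← b.sum_sq_norm_inner_left w]
  refine Finset.sum_le_sum fun i _ => ?_
  rw [Real.norm_eq_abs]
  refine mul_le_of_le_one_left (sq_nonneg _) (Real.exp_le_one_iff.2 ?_)
  have := mul_nonneg (hl i) ht
  linarith

theorem hasDerivAt_exp_neg_smul_mulVec
    (hb : ∀ i, A *ᵥ WithLp.ofLp (b i) = lam i • WithLp.ofLp (b i)) (t : ℝ)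
    (w : EuclideanSpace ℝ (Fin n)) :
    HasDerivAt (fun t : ℝ => (WithLp.toLp 2 (NormedSpace.exp (-(t • A)) *ᵥ WithLp.ofLp w) :
        EuclideanSpace ℝ (Fin n)))
      (-WithLp.toLp 2 (A *ᵥ (NormedSpace.exp (-(t • A)) *ᵥ WithLp.ofLp w))) t := by
  have h1 := mulVec_eq_sum_eigenbasis b hb
    (WithLp.toLp 2 (NormedSpace.exp (-(t • A)) *ᵥ WithLp.ofLp w))
  rw [WithLp.ofLp_toLp] at h1
  simp only [exp_neg_smul_mulVec b hb, h1]
  rw [← Finset.sum_neg_distrib]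
  refine HasDerivAt.fun_sum fun i _ => ?_
  have h2 : HasDerivAt (fun t => Real.exp (-(t * lam i)) * inner ℝ (b i) w)
      (Real.exp (-(t * lam i)) * (-(1 * lam i)) * inner ℝ (b i) w) t :=
    (((hasDerivAt_id t).mul_const (lam i)).neg.exp).mul_const _
  refine (h2.smul_const (b i)).congr_deriv ?_
  rw [b.orthonormal.inner_right_fintype, ← neg_smul]
  congr 1
  ring

end Spectral

/-- The operator norm is at most `n` times the largest modulus of an entry. -/
theorem norm_mulVec_le_of_abs_le {n : ℕ} {D : Matrix (Fin n) (Fin n) ℝ} {h : ℝ}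
    (hD : ∀ i j, |D i j| ≤ h) (w : EuclideanSpace ℝ (Fin n)) :
    ‖(WithLp.toLp 2 (D *ᵥ WithLp.ofLp w) : EuclideanSpace ℝ (Fin n))‖ ≤ n * h * ‖w‖ := by
  rcases Nat.eq_zero_or_pos n with rfl | hn
  · simp [EuclideanSpace.norm_eq]
  have hh : 0 ≤ h := (abs_nonneg _).trans (hD ⟨0, hn⟩ ⟨0, hn⟩)
  refine le_of_sq_le_sq ?_ (by positivity)
  rw [EuclideanSpace.real_norm_sq_eq]
  have hi : ∀ i, (D *ᵥ WithLp.ofLp w) i ^ 2 ≤ n * h ^ 2 * ‖w‖ ^ 2 := by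
    intro i
    have h1 := Finset.sum_mul_sq_le_sq_mul_sq Finset.univ (fun j => D i j) (fun j => w j)
    have h2 : ∑ j, D i j ^ 2 ≤ n * h ^ 2 := by
      refine (Finset.sum_le_sum (g := fun _ => h ^ 2) fun j _ => ?_).trans (by simp)
      exact sq_le_sq' (abs_le.1 (hD i j)).1 (abs_le.1 (hD i j)).2
    rw [EuclideanSpace.real_norm_sq_eq]
    exact h1.trans (mul_le_mul_of_nonneg_right h2 (Finset.sum_nonneg fun _ _ => sq_nonneg _))
  refine (Finset.sum_le_sum fun i _ => hi i).trans (le_of_eq ?_)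
  simp
  ring

/-! ### Deterministic analysis of the residual -/

theorem norm_sum_smul_le {E : Type*} [SeminormedAddCommGroup E] [NormedSpace ℝ E] {n : ℕ}
    (r : EuclideanSpace ℝ (Fin n)) {g : Fin n → E} {c : ℝ} (hc : 0 ≤ c) (hg : ∀ i, ‖g i‖ ≤ c) :
    ‖∑ i, r i • g i‖ ≤ √n * ‖r‖ * c := by
  have h1 : ∑ i, |r i| ≤ √n * ‖r‖ := by
    refine le_of_sq_le_sq ?_ (by positivity)
    rw [mul_pow, Real.sq_sqrt (Nat.cast_nonneg _), EuclideanSpace.real_norm_sq_eq]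
    simpa using sq_sum_le_card_mul_sum_sq (s := Finset.univ) (f := fun i => |r i|)
  calc ‖∑ i, r i • g i‖ ≤ ∑ i, |r i| * c := by
        refine (norm_sum_le _ _).trans (Finset.sum_le_sum fun i _ => ?_)
        rw [norm_smul, Real.norm_eq_abs]
        exact mul_le_mul_of_nonneg_left (hg i) (abs_nonneg _)
    _ = (∑ i, |r i|) * c := by rw [Finset.sum_mul]
    _ ≤ _ := mul_le_mul_of_nonneg_right h1 hc

theorem abs_inner_sub_inner_le {E : Type*} [NormedAddCommGroup E] [InnerProductSpace ℝ E]
    {u v u₀ v₀ : E} {κ ρ : ℝ} (hu₀ : ‖u₀‖ ≤ κ) (hv₀ : ‖v₀‖ ≤ κ)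
    (hu : ‖u - u₀‖ ≤ ρ) (hv : ‖v - v₀‖ ≤ ρ) (hρκ : ρ ≤ κ) :
    |inner ℝ u v - inner ℝ u₀ v₀| ≤ 3 * κ * ρ := by
  have e : (inner ℝ u v : ℝ) - inner ℝ u₀ v₀ =
      inner ℝ (u - u₀) (v - v₀) + inner ℝ (u - u₀) v₀ + inner ℝ u₀ (v - v₀) := by
    simp only [inner_sub_left, inner_sub_right]; ring
  have hρ : 0 ≤ ρ := (norm_nonneg _).trans hu
  have hκ : 0 ≤ κ := hρ.trans hρκ
  have h1 := (abs_real_inner_le_norm (u - u₀) (v - v₀)).trans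
    (mul_le_mul hu hv (norm_nonneg _) hρ)
  have h2 := (abs_real_inner_le_norm (u - u₀) v₀).trans (mul_le_mul hu hv₀ (norm_nonneg _) hρ)
  have h3 := (abs_real_inner_le_norm u₀ (v - v₀)).trans (mul_le_mul hu₀ hv (norm_nonneg _) hκ)
  rw [e]
  refine (abs_add_le _ _).trans ((add_le_add_left (abs_add_le _ _) _).trans ?_)
  nlinarith

section Flow

variable {E : Type*} [NormedAddCommGroup E] [InnerProductSpace ℝ E] [CompleteSpace E] {n : ℕ}
  {f : Fin n → E → ℝ} {g : Fin n → E → E} {y : Fin n → ℝ} {θ : ℝ → E}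

/-- Along a gradient flow of the squared loss the residual solves `∂ₜ r = -(1/n) H(t) r`, with
`H(t)` the Gram matrix of the current gradients. -/
theorem hasDerivWithinAt_residual (hg : ∀ i x, HasGradientAt (f i) (g i x) x)
    (hθ : ∀ t, 0 ≤ t → HasDerivWithinAt θ
      (-((1 / (n : ℝ)) • ∑ i, (f i (θ t) - y i) • g i (θ t))) (Ici 0) t) {t : ℝ} (ht : 0 ≤ t) :
    HasDerivWithinAt (fun t => (WithLp.toLp 2 fun i => f i (θ t) - y i : EuclideanSpace ℝ (Fin n)))
      (-((1 / (n : ℝ)) • WithLp.toLp 2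
        (Matrix.gram ℝ (fun i => g i (θ t)) *ᵥ fun i => f i (θ t) - y i))) (Ici 0) t := by
  have h1 : HasDerivWithinAt (fun t => fun i => f i (θ t) - y i)
      (fun i => -((1 / (n : ℝ)) *
        (Matrix.gram ℝ (fun i => g i (θ t)) *ᵥ fun i => f i (θ t) - y i) i)) (Ici 0) t := by
    rw [hasDerivWithinAt_pi]
    intro i
    refine (((hg i (θ t)).hasFDerivAt.comp_hasDerivWithinAt t (hθ t ht)).sub_const
      (y i)).congr_deriv ?_
    simp only [InnerProductSpace.toDual_apply_apply, inner_neg_right, real_inner_smul_right,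
      inner_sum, Matrix.mulVec, dotProduct, Matrix.gram, Matrix.of_apply]
    simp only [mul_comm]
  exact (EuclideanSpace.equiv (Fin n) ℝ).symm.toContinuousLinearMap.hasFDerivAt
    |>.comp_hasDerivWithinAt t h1

/-- A lower bound `l` for the quadratic form of the Gram matrix up to time `T` gives exponential
decay of the residual at rate `l / n` up to time `T`. -/
theorem norm_residual_le_exp (hn : 0 < n) (hg : ∀ i x, HasGradientAt (f i) (g i x) x)
    (hθ : ∀ t, 0 ≤ t → HasDerivWithinAt θ
      (-((1 / (n : ℝ)) • ∑ i, (f i (θ t) - y i) • g i (θ t))) (Ici 0) t) {l T : ℝ}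
    (hl : ∀ t, 0 ≤ t → t ≤ T → ∀ w : EuclideanSpace ℝ (Fin n), l * ‖w‖ ^ 2 ≤
      inner ℝ w (WithLp.toLp 2 (Matrix.gram ℝ (fun i => g i (θ t)) *ᵥ WithLp.ofLp w))) :
    ∀ t, 0 ≤ t → t ≤ T →
      ‖(WithLp.toLp 2 fun i => f i (θ t) - y i : EuclideanSpace ℝ (Fin n))‖ ≤
        ‖(WithLp.toLp 2 fun i => f i (θ 0) - y i : EuclideanSpace ℝ (Fin n))‖ *
          Real.exp (-(l / n) * t) := by
  intro t ht htT
  have hn' : (0 : ℝ) < n := by exact_mod_cast hn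
  have h := le_add_mul_exp_of_deriv_le (β := 2 * l / n) (c := 0) (T := T)
    (fun t ht => (hasDerivWithinAt_residual hg hθ ht).norm_sq) (fun t ht htT => ?_) t ht htT
  · refine le_of_sq_le_sq ?_ (by positivity)
    rw [mul_pow, ← Real.exp_nat_mul]
    refine h.trans (le_of_eq ?_)
    rw [zero_add, sub_zero]
    congr 2
    push_cast
    ring
  · have := hl t ht htT (WithLp.toLp 2 fun i => f i (θ t) - y i)
    rw [inner_neg_right, real_inner_smul_right]
    have h2 := mul_le_mul_of_nonneg_left this (show 0 ≤ 2 / (n : ℝ) by positivity)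
    calc _ = -(2 / (n : ℝ) * inner ℝ (WithLp.toLp 2 fun i => f i (θ t) - y i)
          (WithLp.toLp 2 (Matrix.gram ℝ (fun i => g i (θ t)) *ᵥ fun i => f i (θ t) - y i))) := by
            ring
      _ ≤ _ := neg_le_neg h2
      _ = _ := by ring

/-- Comparison of the residual of a gradient flow with the flow of the linearized kernel dynamics,
as long as the Gram matrix of the gradients is entrywise `h`-close to a fixed symmetric matrix `A`
with spectrum at least `l`. -/
theorem norm_residual_sub_exp_le (hn : 0 < n) (hg : ∀ i x, HasGradientAt (f i) (g i x) x)
    (hθ : ∀ t, 0 ≤ t → HasDerivWithinAt θ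
      (-((1 / (n : ℝ)) • ∑ i, (f i (θ t) - y i) • g i (θ t))) (Ici 0) t)
    {A : Matrix (Fin n) (Fin n) ℝ} (b : OrthonormalBasis (Fin n) ℝ (EuclideanSpace ℝ (Fin n)))
    {lam : Fin n → ℝ} (hb : ∀ i, A *ᵥ WithLp.ofLp (b i) = lam i • WithLp.ofLp (b i))
    {l h : ℝ} (hl0 : 0 < l) (hl : ∀ i, l ≤ lam i)
    (hA : ∀ t, 0 ≤ t → ∀ i j, |Matrix.gram ℝ (fun i => g i (θ t)) i j - A i j| ≤ h)
    {Y : ℝ} (hY : ∀ t, 0 ≤ t →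
      ‖(WithLp.toLp 2 fun i => f i (θ t) - y i : EuclideanSpace ℝ (Fin n))‖ ≤ Y) :
    ∀ t, 0 ≤ t → ‖(WithLp.toLp 2 fun i => f i (θ t) - y i : EuclideanSpace ℝ (Fin n)) -
      WithLp.toLp 2 (NormedSpace.exp (-(t • ((1 / (n : ℝ)) • A))) *ᵥ fun i => f i (θ 0) - y i)‖ ≤
        n * h * Y / l := by
  intro t ht
  have hn' : (0 : ℝ) < n := by exact_mod_cast hn
  have hh : 0 ≤ h := (abs_nonneg _).trans (hA 0 le_rfl ⟨0, hn⟩ ⟨0, hn⟩)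
  have hY0 : 0 ≤ Y := (norm_nonneg _).trans (hY 0 le_rfl)
  have hbn : ∀ i, ((1 / (n : ℝ)) • A) *ᵥ WithLp.ofLp (b i) =
      (1 / (n : ℝ) * lam i) • WithLp.ofLp (b i) := by
    intro i
    rw [Matrix.smul_mulVec, hb, smul_smul]
  set r : ℝ → EuclideanSpace ℝ (Fin n) := fun t => WithLp.toLp 2 fun i => f i (θ t) - y i with hr
  set p : ℝ → EuclideanSpace ℝ (Fin n) := fun t =>
    WithLp.toLp 2 (NormedSpace.exp (-(t • ((1 / (n : ℝ)) • A))) *ᵥ WithLp.ofLp (r 0)) with hp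
  have hΔ : ∀ t, 0 ≤ t → HasDerivWithinAt (fun t => r t - p t)
      (-((1 / (n : ℝ)) • WithLp.toLp 2 (A *ᵥ WithLp.ofLp (r t - p t))) - (1 / (n : ℝ)) •
        WithLp.toLp 2 ((Matrix.gram ℝ (fun i => g i (θ t)) - A) *ᵥ WithLp.ofLp (r t)))
        (Ici 0) t := by
    intro t ht
    refine ((hasDerivWithinAt_residual hg hθ ht).sub
      (hasDerivAt_exp_neg_smul_mulVec b hbn t (r 0)).hasDerivWithinAt).congr_deriv ?_
    ext k
    simp only [hr, hp, Matrix.smul_mulVec, Matrix.sub_mulVec, Matrix.mulVec_sub, WithLp.ofLp_sub,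
      WithLp.ofLp_toLp, Pi.sub_apply,
      Pi.smul_apply, smul_eq_mul, PiLp.sub_apply, PiLp.neg_apply, PiLp.smul_apply]
    ring
  have hfin := le_add_mul_exp_of_deriv_le (β := l / n) (c := (n * h * Y / l) ^ 2) (T := t)
    (fun t ht => (hΔ t ht).norm_sq) (fun s hs _ => ?_) t ht le_rfl
  · have h0 : r 0 - p 0 = 0 := by simp [hp]
    rw [h0, norm_zero] at hfin
    refine le_of_sq_le_sq (hfin.trans ?_) (by positivity)
    have : 0 ≤ (n * h * Y / l) ^ 2 * Real.exp (-(l / n) * t) := by positivity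
    linarith
  · have e1 := inner_mulVec_ge b hb hl (r s - p s)
    have e2 : |inner ℝ (r s - p s) (WithLp.toLp 2
        ((Matrix.gram ℝ (fun i => g i (θ s)) - A) *ᵥ WithLp.ofLp (r s)))| ≤
          ‖r s - p s‖ * (n * h * Y) := by
      refine (abs_real_inner_le_norm _ _).trans (mul_le_mul_of_nonneg_left ?_ (norm_nonneg _))
      refine (norm_mulVec_le_of_abs_le (h := h) (fun i j => ?_) (r s)).trans
        (mul_le_mul_of_nonneg_left (hY s hs) (by positivity))
      simpa using hA s hs i j
    rw [inner_sub_right, inner_neg_right, real_inner_smul_right, real_inner_smul_right]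
    set u := ‖r s - p s‖
    set I := inner ℝ (r s - p s) (WithLp.toLp 2 (A *ᵥ WithLp.ofLp (r s - p s)))
    set J := inner ℝ (r s - p s) (WithLp.toLp 2
        ((Matrix.gram ℝ (fun i => g i (θ s)) - A) *ᵥ WithLp.ofLp (r s)))
    have e3 := neg_le_of_abs_le e2
    have e4 : 2 * u * (n * h * Y) ≤ l * u ^ 2 + (n * h * Y) ^ 2 / l := by
      have : 0 ≤ (l * u - n * h * Y) ^ 2 / l := by positivity
      have e : (l * u - n * h * Y) ^ 2 / l = l * u ^ 2 - 2 * u * (n * h * Y) +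
          (n * h * Y) ^ 2 / l := by field_simp; ring
      linarith
    have e5 : 2 * (-(1 / (n : ℝ) * I) - 1 / n * J) ≤
        (-(l * u ^ 2) + (n * h * Y) ^ 2 / l) / n := by
      rw [le_div_iff₀ hn']
      have : 2 * (-(1 / (n : ℝ) * I) - 1 / n * J) * n = -2 * I - 2 * J := by field_simp
      rw [this]
      linarith
    refine e5.trans (le_of_eq ?_)
    field_simp
    ring

/-- Lazy training. Assume that at time `0` the Gram matrix is `η`-close to `A`, the gradients have
norm at most `κ`, and they are `Λ`-Lipschitz. While the gradients have moved by at most `ρ`, the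
Gram matrix keeps half of the spectral gap `l`, the residual decays exponentially, and the
parameters move by at most `4 κ √n Y / l`. If `Λ` times this is at most `ρ / 2`, the bootstrap
closes and the comparison with the kernel dynamics holds for all times. -/
theorem norm_residual_sub_exp_le_of_lazy (hn : 0 < n) (hg : ∀ i x, HasGradientAt (f i) (g i x) x)
    (hgc : ∀ i, Continuous (g i))
    (hθ : ∀ t, 0 ≤ t → HasDerivWithinAt θ
      (-((1 / (n : ℝ)) • ∑ i, (f i (θ t) - y i) • g i (θ t))) (Ici 0) t)
    {A : Matrix (Fin n) (Fin n) ℝ} (b : OrthonormalBasis (Fin n) ℝ (EuclideanSpace ℝ (Fin n)))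
    {lam : Fin n → ℝ} (hb : ∀ i, A *ᵥ WithLp.ofLp (b i) = lam i • WithLp.ofLp (b i))
    {l : ℝ} (hl0 : 0 < l) (hl : ∀ i, l ≤ lam i)
    {η κ ρ Λ Y : ℝ} (hA : ∀ i j, |Matrix.gram ℝ (fun i => g i (θ 0)) i j - A i j| ≤ η)
    (hκ : ∀ i, ‖g i (θ 0)‖ ≤ κ) (hρ0 : 0 < ρ) (hρκ : ρ ≤ κ) (hΛ0 : 0 ≤ Λ)
    (hΛ : ∀ i x, ‖g i x - g i (θ 0)‖ ≤ Λ * ‖x - θ 0‖)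
    (hY : ‖(WithLp.toLp 2 fun i => f i (θ 0) - y i : EuclideanSpace ℝ (Fin n))‖ ≤ Y)
    (hlazy : Λ * (4 * κ * √n * Y / l) ≤ ρ / 2) (hsmall : n * (η + 3 * κ * ρ) ≤ l / 2) :
    ∀ t, 0 ≤ t → ‖(WithLp.toLp 2 fun i => f i (θ t) - y i : EuclideanSpace ℝ (Fin n)) -
      WithLp.toLp 2 (NormedSpace.exp (-(t • ((1 / (n : ℝ)) • A))) *ᵥ fun i => f i (θ 0) - y i)‖ ≤
        n * (η + 3 * κ * ρ) * Y / l := by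
  have hn' : (0 : ℝ) < n := by exact_mod_cast hn
  have hκ0 : 0 < κ := hρ0.trans_le hρκ
  have hgram : ∀ s, (∀ i, ‖g i (θ s) - g i (θ 0)‖ ≤ ρ) →
      ∀ i j, |Matrix.gram ℝ (fun i => g i (θ s)) i j - A i j| ≤ η + 3 * κ * ρ := by
    intro s hs i j
    have h1 := abs_inner_sub_inner_le (hκ i) (hκ j) (hs i) (hs j) hρκ
    have h2 := abs_sub_le (Matrix.gram ℝ (fun i => g i (θ s)) i j)
      (Matrix.gram ℝ (fun i => g i (θ 0)) i j) (A i j)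
    have h3 := hA i j
    have h4 : |Matrix.gram ℝ (fun i => g i (θ s)) i j -
        Matrix.gram ℝ (fun i => g i (θ 0)) i j| ≤ 3 * κ * ρ := h1
    linarith
  have hdecay : ∀ T, 0 ≤ T → (∀ s, 0 ≤ s → s ≤ T → ∀ i, ‖g i (θ s) - g i (θ 0)‖ ≤ ρ) →
      ∀ t, 0 ≤ t → t ≤ T →
      ‖(WithLp.toLp 2 fun i => f i (θ t) - y i : EuclideanSpace ℝ (Fin n))‖ ≤
        Y * Real.exp (-(l / 2 / n) * t) := by
    intro T hT hs t ht htT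
    refine (norm_residual_le_exp (l := l / 2) hn hg hθ (fun t ht htT w => ?_) t ht htT).trans
      (mul_le_mul_of_nonneg_right hY (Real.exp_pos _).le)
    have e1 := inner_mulVec_ge b hb hl w
    have e2 : |inner ℝ w (WithLp.toLp 2
        ((Matrix.gram ℝ (fun i => g i (θ t)) - A) *ᵥ WithLp.ofLp w))| ≤
        l / 2 * ‖w‖ ^ 2 := by
      refine (abs_real_inner_le_norm _ _).trans ?_
      have := norm_mulVec_le_of_abs_le (D := Matrix.gram ℝ (fun i => g i (θ t)) - A)
        (fun i j => by simpa using hgram t (hs t ht htT) i j) w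
      have h3 := mul_le_mul_of_nonneg_left (this.trans
        (mul_le_mul_of_nonneg_right hsmall (norm_nonneg _))) (norm_nonneg w)
      refine h3.trans (le_of_eq (by ring))
    have e3 : (inner ℝ w (WithLp.toLp 2
        (Matrix.gram ℝ (fun i => g i (θ t)) *ᵥ WithLp.ofLp w)) : ℝ) =
        inner ℝ w (WithLp.toLp 2 (A *ᵥ WithLp.ofLp w)) +
        inner ℝ w (WithLp.toLp 2 ((Matrix.gram ℝ (fun i => g i (θ t)) - A) *ᵥ WithLp.ofLp w)) := by
      rw [← inner_add_right, ← WithLp.toLp_add, ← Matrix.add_mulVec]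
      congr 4
      abel
    rw [e3]
    have := neg_le_of_abs_le e2
    linarith
  -- the bootstrap runs on the largest displacement of the `n` gradients
  have hq : ∀ t, 0 ≤ t → ‖fun i => g i (θ t) - g i (θ 0)‖ ≤ ρ := by
    refine forall_le_of_forall_le_half hρ0 ?_ (by simp [← Pi.zero_def]) ?_
    · refine ContinuousOn.norm (continuousOn_pi.2 fun i => ?_)
      refine ContinuousOn.sub ((hgc i).comp_continuousOn fun t ht => ?_) continuousOn_const
      exact (hθ t ht).continuousWithinAt
    · intro T hT hs
      have hs' : ∀ s, 0 ≤ s → s ≤ T → ∀ i, ‖g i (θ s) - g i (θ 0)‖ ≤ ρ := fun s h0 hsT i =>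
        (norm_le_pi_norm (fun i => g i (θ s) - g i (θ 0)) i).trans (hs s h0 hsT)
      have hdisp := norm_sub_le_of_norm_deriv_le_exp (β := l / 2 / n) (T := T)
        (c := 1 / n * (√n * Y * (2 * κ))) (by positivity) hθ (fun t ht htT => ?_) T hT le_rfl
      · refine (pi_norm_le_iff_of_nonneg (by positivity)).2 fun i => (hΛ i _).trans ?_
        refine (mul_le_mul_of_nonneg_left (hdisp.trans (le_of_eq ?_)) hΛ0).trans hlazy
        field_simp
        ring
      · rw [norm_neg, norm_smul, Real.norm_eq_abs, abs_of_pos (by positivity)]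
        have h1 := norm_sum_smul_le (WithLp.toLp 2 fun i => f i (θ t) - y i) (c := 2 * κ)
          (g := fun i => g i (θ t)) (by positivity) (fun i => by
            have := norm_le_norm_add_norm_sub' (g i (θ t)) (g i (θ 0))
            have := hκ i
            have := hs' t ht htT i
            linarith)
        have h2 := hdecay T hT hs' t ht htT
        have h3 : √n * ‖(WithLp.toLp 2 fun i => f i (θ t) - y i : EuclideanSpace ℝ (Fin n))‖ *
            (2 * κ) ≤ √n * (Y * Real.exp (-(l / 2 / n) * t)) * (2 * κ) := by gcongr
        refine (mul_le_mul_of_nonneg_left (h1.trans h3) (by positivity)).trans (le_of_eq ?_)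
        ring
  have hq' : ∀ s, 0 ≤ s → ∀ i, ‖g i (θ s) - g i (θ 0)‖ ≤ ρ := fun s hs i =>
    (norm_le_pi_norm (fun i => g i (θ s) - g i (θ 0)) i).trans (hq s hs)
  refine norm_residual_sub_exp_le hn hg hθ b hb hl0 hl (fun t ht => hgram t (hq' t ht)) ?_
  intro t ht
  refine (hdecay t ht (fun s hs _ => hq' s hs) t ht le_rfl).trans ?_
  have hY0 : 0 ≤ Y := (norm_nonneg _).trans hY
  refine mul_le_of_le_one_right hY0 (Real.exp_le_one_iff.2 ?_)
  have : 0 ≤ l / 2 / n * t := by positivity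
  linarith

end Flow

/-! ### Subgaussian laws, concentration and independence -/

theorem exp_le_one_add_add_sq_mul_exp_abs (u : ℝ) :
    Real.exp u ≤ 1 + u + u ^ 2 * Real.exp |u| := by
  have h1 : 1 ≤ Real.exp |u| := Real.one_le_exp (abs_nonneg u)
  rcases le_or_gt |u| 1 with h | h
  · have := (abs_le.1 (Real.abs_exp_sub_one_sub_id_le h)).2
    nlinarith [sq_nonneg u]
  · rcases lt_abs.1 h with h2 | h2
    · rw [abs_of_pos (by linarith)]
      have h3 : 0 ≤ (u ^ 2 - 1) * Real.exp u :=
        mul_nonneg (by nlinarith) (Real.exp_pos u).le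
      linarith
    · have h3 : Real.exp u ≤ 1 := Real.exp_le_one_iff.2 (by linarith)
      nlinarith [sq_nonneg u]

section Bernstein

variable {Ω : Type*} [MeasurableSpace Ω] {P : Measure Ω}

theorem integrable_of_integrable_exp_abs_div {X : Ω → ℝ} (hX : Measurable X) {τ : ℝ} (hτ : 0 < τ)
    (hint : Integrable (fun ω => Real.exp (|X ω| / τ)) P) : Integrable X P := by
  refine (hint.const_mul τ).mono' hX.aestronglyMeasurable (ae_of_all _ fun ω => ?_)
  have := Real.add_one_le_exp (|X ω| / τ)
  have h2 : |X ω| = τ * (|X ω| / τ) := by field_simp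
  rw [Real.norm_eq_abs]
  nlinarith

theorem abs_integral_le_of_integral_exp_abs_div_le {X : Ω → ℝ} {τ A : ℝ}
    (hτ : 0 < τ) (hint : Integrable (fun ω => Real.exp (|X ω| / τ)) P)
    (hA : ∫ ω, Real.exp (|X ω| / τ) ∂P ≤ A) : |∫ ω, X ω ∂P| ≤ τ * A := by
  rw [← Real.norm_eq_abs]
  refine (norm_integral_le_of_norm_le (hint.const_mul τ) (ae_of_all _ fun ω => ?_)).trans ?_
  · have := Real.add_one_le_exp (|X ω| / τ)
    have h2 : |X ω| = τ * (|X ω| / τ) := by field_simp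
    rw [Real.norm_eq_abs]
    nlinarith
  · rw [integral_const_mul]
    exact mul_le_mul_of_nonneg_left hA hτ.le

variable [IsProbabilityMeasure P]

/-- A centred variable with an exponential moment at scale `τ` has a subgaussian moment generating
function on `|s| ≤ 1 / (2τ)`. -/
theorem integrable_exp_mul_and_mgf_le {X : Ω → ℝ} (hX : Measurable X) {τ A : ℝ} (hτ : 0 < τ)
    (hint : Integrable (fun ω => Real.exp (|X ω| / τ)) P)
    (hA : ∫ ω, Real.exp (|X ω| / τ) ∂P ≤ A) (hmean : ∫ ω, X ω ∂P = 0) {s : ℝ}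
    (hs : |s| * τ ≤ 1 / 2) :
    Integrable (fun ω => Real.exp (s * X ω)) P ∧
      mgf X P s ≤ Real.exp (8 * A * τ ^ 2 * s ^ 2) := by
  have hsX : ∀ ω, |s * X ω| ≤ |X ω| / τ / 2 := by
    intro ω
    rw [abs_mul, div_div, le_div_iff₀ (by positivity)]
    nlinarith [abs_nonneg (X ω)]
  have hexp : Integrable (fun ω => Real.exp (s * X ω)) P := by
    refine hint.mono' (by fun_prop) (ae_of_all _ fun ω => ?_)
    rw [Real.norm_eq_abs, abs_of_pos (Real.exp_pos _), Real.exp_le_exp]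
    have := le_abs_self (s * X ω)
    have := hsX ω
    have : 0 ≤ |X ω| / τ := by positivity
    linarith
  refine ⟨hexp, ?_⟩
  have hpt : ∀ ω, Real.exp (s * X ω) ≤
      1 + s * X ω + 8 * τ ^ 2 * s ^ 2 * Real.exp (|X ω| / τ) := by
    intro ω
    refine (exp_le_one_add_add_sq_mul_exp_abs _).trans ?_
    set v := |X ω| / τ / 2
    have hv : 0 ≤ v := by positivity
    have e1 : (s * X ω) ^ 2 = 4 * τ ^ 2 * s ^ 2 * v ^ 2 := by
      simp only [v]
      rw [div_pow, div_pow, sq_abs]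
      field_simp
      ring
    have e2 : v ^ 2 ≤ 2 * Real.exp v := by
      have := Real.quadratic_le_exp_of_nonneg hv
      nlinarith
    have e3 : Real.exp |s * X ω| ≤ Real.exp v := Real.exp_le_exp.2 (hsX ω)
    have e4 : Real.exp (|X ω| / τ) = Real.exp v * Real.exp v := by
      rw [← Real.exp_add]; simp only [v]; ring_nf
    have e5 : v ^ 2 * Real.exp |s * X ω| ≤ 2 * Real.exp v * Real.exp v :=
      mul_le_mul e2 e3 (Real.exp_pos _).le (by positivity)
    have e6 := mul_le_mul_of_nonneg_left e5 (show 0 ≤ 4 * τ ^ 2 * s ^ 2 by positivity)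
    rw [e1, e4]
    linarith
  have hXi := integrable_of_integrable_exp_abs_div hX hτ hint
  calc mgf X P s ≤ ∫ ω, (1 + s * X ω + 8 * τ ^ 2 * s ^ 2 * Real.exp (|X ω| / τ)) ∂P :=
        integral_mono hexp (((integrable_const 1).add (hXi.const_mul s)).add
          (hint.const_mul _)) hpt
    _ = 1 + 8 * τ ^ 2 * s ^ 2 * ∫ ω, Real.exp (|X ω| / τ) ∂P := by
        have hadd : Integrable (fun ω => 1 + s * X ω) P :=
          (integrable_const 1).add (hXi.const_mul s)
        rw [integral_add hadd (hint.const_mul _),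
          integral_add (integrable_const 1) (hXi.const_mul s), integral_const_mul,
          integral_const_mul, hmean]
        simp
    _ ≤ 8 * A * τ ^ 2 * s ^ 2 + 1 := by
        have := mul_le_mul_of_nonneg_left hA (show 0 ≤ 8 * τ ^ 2 * s ^ 2 by positivity)
        linarith
    _ ≤ _ := Real.add_one_le_exp _

/-- The one-sided, centred case of Bernstein's inequality, by Chernoff's bound. -/
theorem measure_sum_ge_le_of_integral_exp_abs_div_le {ι : Type*} [Fintype ι] {X : ι → Ω → ℝ}
    (hind : iIndepFun X P) (hX : ∀ i, Measurable (X i)) {τ A η : ℝ} (hτ : 0 < τ) (hA0 : 0 < A)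
    (hint : ∀ i, Integrable (fun ω => Real.exp (|X i ω| / τ)) P)
    (hA : ∀ i, ∫ ω, Real.exp (|X i ω| / τ) ∂P ≤ A) (hmean : ∀ i, ∫ ω, X i ω ∂P = 0)
    (hη0 : 0 ≤ η) (hη : η ≤ 8 * A * τ) :
    P.real {ω | Fintype.card ι * η ≤ ∑ i, X i ω} ≤
      Real.exp (-(Fintype.card ι * η ^ 2 / (32 * A * τ ^ 2))) := by
  -- the value of `s` minimizing the exponent `8 A τ² s² - s η`
  set s := η / (16 * A * τ ^ 2) with hs
  have hs0 : 0 ≤ s := by positivity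
  have hsτ : |s| * τ ≤ 1 / 2 := by
    rw [abs_of_nonneg hs0, hs, div_mul_eq_mul_div, div_le_iff₀ (by positivity)]
    nlinarith
  have hb := fun i => integrable_exp_mul_and_mgf_le (hX i) hτ (hint i) (hA i) (hmean i) hsτ
  have hsum : (fun ω => ∑ i, X i ω) = ∑ i, X i := by ext; simp
  have h1 := measure_ge_le_exp_mul_mgf (μ := P) (X := ∑ i, X i) (Fintype.card ι * η) hs0
    (hind.integrable_exp_mul_sum hX (fun i _ => (hb i).1))
  rw [hind.mgf_sum hX] at h1
  simp only [Finset.sum_apply] at h1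
  have h2 : ∏ i, mgf (X i) P s ≤ Real.exp (Fintype.card ι * (8 * A * τ ^ 2 * s ^ 2)) := by
    refine (Finset.prod_le_prod (fun i _ => mgf_nonneg) fun i _ => (hb i).2).trans ?_
    rw [Finset.prod_const, Finset.card_univ, ← Real.exp_nat_mul]
  refine (h1.trans (mul_le_mul_of_nonneg_left h2 (Real.exp_pos _).le)).trans ?_
  rw [← Real.exp_add, Real.exp_le_exp, hs]
  apply le_of_eq
  field_simp
  ring

/-- **Bernstein's inequality** for independent random variables with bounded exponential moment. -/
theorem measure_abs_sum_sub_integral_ge_le {ι : Type*} [Fintype ι] {X : ι → Ω → ℝ}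
    (hind : iIndepFun X P) (hX : ∀ i, Measurable (X i)) {τ A η : ℝ} (hτ : 0 < τ) (hA0 : 0 < A)
    (hint : ∀ i, Integrable (fun ω => Real.exp (|X i ω| / τ)) P)
    (hA : ∀ i, ∫ ω, Real.exp (|X i ω| / τ) ∂P ≤ A)
    (hη0 : 0 ≤ η) (hη : η ≤ 8 * A * τ) :
    P.real {ω | Fintype.card ι * η ≤ |∑ i, (X i ω - ∫ ω', X i ω' ∂P)|} ≤
      2 * Real.exp (-(Fintype.card ι * η ^ 2 / (32 * (A * Real.exp A) * τ ^ 2))) := by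
  have hXi := fun i => integrable_of_integrable_exp_abs_div (hX i) hτ (hint i)
  have hE := fun i => abs_integral_le_of_integral_exp_abs_div_le hτ (hint i) (hA i)
  have hpt : ∀ i ω, Real.exp (|X i ω - ∫ ω', X i ω' ∂P| / τ) ≤
      Real.exp A * Real.exp (|X i ω| / τ) := by
    intro i ω
    rw [← Real.exp_add, Real.exp_le_exp, div_le_iff₀ hτ, add_mul, div_mul_cancel₀ _ hτ.ne']
    have := abs_sub (X i ω) (∫ ω', X i ω' ∂P)
    linarith [hE i]
  have hXc : ∀ i, Measurable fun ω => X i ω - ∫ ω', X i ω' ∂P := fun i => (hX i).sub_const _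
  have hintc : ∀ i, Integrable (fun ω => Real.exp (|X i ω - ∫ ω', X i ω' ∂P| / τ)) P := by
    intro i
    have hm := hXc i
    refine ((hint i).const_mul (Real.exp A)).mono' (by fun_prop) (ae_of_all _ fun ω => ?_)
    rw [Real.norm_eq_abs, abs_of_pos (Real.exp_pos _)]
    exact hpt i ω
  have hAc : ∀ i, ∫ ω, Real.exp (|X i ω - ∫ ω', X i ω' ∂P| / τ) ∂P ≤ A * Real.exp A := by
    intro i
    refine (integral_mono (hintc i) ((hint i).const_mul _) (hpt i)).trans ?_
    rw [integral_const_mul, mul_comm]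
    exact mul_le_mul_of_nonneg_right (hA i) (Real.exp_pos _).le
  have hmean : ∀ i, ∫ ω, (X i ω - ∫ ω', X i ω' ∂P) ∂P = 0 := by
    intro i
    rw [integral_sub (hXi i) (integrable_const _)]
    simp
  have hη' : η ≤ 8 * (A * Real.exp A) * τ := by
    refine hη.trans ?_
    have : A ≤ A * Real.exp A := le_mul_of_one_le_right hA0.le (Real.one_le_exp hA0.le)
    gcongr
  have hindc : iIndepFun (fun i ω => X i ω - ∫ ω', X i ω' ∂P) P :=
    hind.comp (fun i x => x - ∫ ω', X i ω' ∂P) (fun i => by fun_prop)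
  have hup := measure_sum_ge_le_of_integral_exp_abs_div_le hindc hXc hτ
    (by positivity) hintc hAc hmean hη0 hη'
  have hindn : iIndepFun (fun i ω => -(X i ω - ∫ ω', X i ω' ∂P)) P :=
    hindc.comp (fun i x => -x) (fun i => by fun_prop)
  have hdn := measure_sum_ge_le_of_integral_exp_abs_div_le hindn (fun i => (hXc i).neg) hτ
    (by positivity) (by simpa only [abs_neg] using hintc) (by simpa only [abs_neg] using hAc)
    (fun i => by rw [integral_neg, hmean, neg_zero]) hη0 hη'
  have hsub : {ω | Fintype.card ι * η ≤ |∑ i, (X i ω - ∫ ω', X i ω' ∂P)|} ⊆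
      {ω | Fintype.card ι * η ≤ ∑ i, (X i ω - ∫ ω', X i ω' ∂P)} ∪
      {ω | Fintype.card ι * η ≤ ∑ i, -(X i ω - ∫ ω', X i ω' ∂P)} := by
    intro ω hω
    rw [mem_union, mem_ofPred_eq, mem_ofPred_eq, Finset.sum_neg_distrib]
    exact le_abs.1 hω
  refine (measureReal_mono hsub).trans ((measureReal_union_le _ _).trans ?_)
  linarith

end Bernstein

section Subgaussian

variable {Ω : Type*} [MeasurableSpace Ω] {P : Measure Ω}

/-- The moment generating function of the standard Gaussian, without the normalization. -/
theorem lintegral_exp_neg_sq_div_add (r : ℝ) :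
    ∫⁻ g : ℝ, ENNReal.ofReal (Real.exp (-(g ^ 2) / 2 + r * g)) =
      ENNReal.ofReal (√(2 * Real.pi) * Real.exp (r ^ 2 / 2)) := by
  have h1 : ∀ g : ℝ, ENNReal.ofReal (Real.exp (-(g ^ 2) / 2 + r * g)) =
      ENNReal.ofReal (Real.exp (r ^ 2 / 2)) *
        ENNReal.ofReal (Real.exp (-(1 / 2) * (g - r) ^ 2)) := by
    intro g
    rw [← ENNReal.ofReal_mul (Real.exp_pos _).le, ← Real.exp_add]
    congr 2
    ring
  simp_rw [h1]
  rw [lintegral_const_mul _ (by fun_prop),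
    lintegral_sub_right_eq_self (fun g => ENNReal.ofReal (Real.exp (-(1 / 2) * g ^ 2))) r,
    ← ofReal_integral_eq_lintegral_ofReal (integrable_exp_neg_mul_sq (by norm_num))
      (ae_of_all _ fun _ => (Real.exp_pos _).le), integral_gaussian, mul_comm,
    ← ENNReal.ofReal_mul (by positivity)]
  congr 3
  field_simp

/-- The square of a subgaussian variable has an exponential moment: write `exp (s Z²)` as a
Gaussian average of `exp (√(2s) g Z)` and integrate over `Z` first. -/
theorem _root_.ProbabilityTheory.HasSubgaussianMGF.lintegral_exp_mul_sq_le [IsProbabilityMeasure P]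
    {Z : Ω → ℝ} (hZm : Measurable Z) {c : ℝ≥0} (hZ : HasSubgaussianMGF Z c P) {s : ℝ} (hs : 0 ≤ s)
    (hsc : c * s ≤ 1 / 4) :
    ∫⁻ ω, ENNReal.ofReal (Real.exp (s * Z ω ^ 2)) ∂P ≤ 2 := by
  have hpi : 0 < √(2 * Real.pi) := Real.sqrt_pos.2 (by positivity)
  have h1 : ∀ ω, ∫⁻ g : ℝ, ENNReal.ofReal (Real.exp (-(g ^ 2) / 2 + (√(2 * s) * Z ω) * g)) =
      ENNReal.ofReal (√(2 * Real.pi)) * ENNReal.ofReal (Real.exp (s * Z ω ^ 2)) := by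
    intro ω
    rw [lintegral_exp_neg_sq_div_add, ENNReal.ofReal_mul hpi.le, mul_pow,
      Real.sq_sqrt (by positivity)]
    congr 3
    ring
  have h2 : ∫⁻ ω, (∫⁻ g : ℝ,
      ENNReal.ofReal (Real.exp (-(g ^ 2) / 2 + (√(2 * s) * Z ω) * g))) ∂P ≤
        ENNReal.ofReal (√(Real.pi / (1 / 4))) := by
    rw [lintegral_lintegral_swap (by fun_prop)]
    calc ∫⁻ g : ℝ, ∫⁻ ω,
          ENNReal.ofReal (Real.exp (-(g ^ 2) / 2 + (√(2 * s) * Z ω) * g)) ∂P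
        ≤ ∫⁻ g : ℝ, ENNReal.ofReal (Real.exp (-(1 / 4) * g ^ 2)) := by
          refine lintegral_mono fun g => ?_
          have e1 : ∀ ω, Real.exp (-(g ^ 2) / 2 + (√(2 * s) * Z ω) * g) =
              Real.exp (-(g ^ 2) / 2) * Real.exp ((√(2 * s) * g) * Z ω) := by
            intro ω
            rw [← Real.exp_add]
            ring_nf
          simp_rw [e1]
          rw [← ofReal_integral_eq_lintegral_ofReal ((hZ.integrable_exp_mul _).const_mul _)
            (ae_of_all _ fun _ => by positivity), integral_const_mul]
          refine ENNReal.ofReal_le_ofReal ?_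
          refine (mul_le_mul_of_nonneg_left (hZ.mgf_le (√(2 * s) * g))
            (Real.exp_pos _).le).trans ?_
          rw [← Real.exp_add, Real.exp_le_exp, mul_pow, Real.sq_sqrt (by positivity)]
          nlinarith [sq_nonneg g]
      _ = _ := by
          rw [← ofReal_integral_eq_lintegral_ofReal (integrable_exp_neg_mul_sq (by norm_num))
            (ae_of_all _ fun _ => (Real.exp_pos _).le), integral_gaussian]
  simp_rw [h1] at h2
  rw [lintegral_const_mul _ (by fun_prop)] at h2
  have h3 : ENNReal.ofReal (√(Real.pi / (1 / 4))) ≤ ENNReal.ofReal (√(2 * Real.pi)) * 2 := by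
    rw [show (2 : ℝ≥0∞) = ENNReal.ofReal 2 by simp, ← ENNReal.ofReal_mul hpi.le]
    refine ENNReal.ofReal_le_ofReal (Real.sqrt_le_iff.2 ⟨by positivity, ?_⟩)
    rw [mul_pow, Real.sq_sqrt (by positivity)]
    nlinarith [Real.pi_pos]
  have h4 := h2.trans h3
  rwa [ENNReal.mul_le_mul_iff_right (ENNReal.ofReal_pos.2 hpi).ne' ENNReal.ofReal_ne_top] at h4

theorem integrable_and_integral_le_of_lintegral_ofReal_le {h : Ω → ℝ} (hm : Measurable h)
    (h0 : ∀ ω, 0 ≤ h ω) {c : ℝ} (hc : 0 ≤ c)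
    (hle : ∫⁻ ω, ENNReal.ofReal (h ω) ∂P ≤ ENNReal.ofReal c) :
    Integrable h P ∧ ∫ ω, h ω ∂P ≤ c := by
  have hi : Integrable h P := by
    refine ⟨hm.aestronglyMeasurable, ?_⟩
    rw [hasFiniteIntegral_iff_ofReal (ae_of_all _ h0)]
    exact hle.trans_lt ENNReal.ofReal_lt_top
  refine ⟨hi, ?_⟩
  rw [← ofReal_integral_eq_lintegral_ofReal hi (ae_of_all _ h0)] at hle
  exact (ENNReal.ofReal_le_ofReal_iff hc).1 hle

/-- The infimum in the `ψ₂` norm need not be attained; passing from `K` to the strictly larger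
`|K| + 1` makes the defining moment bound available. -/
theorem lintegral_exp_sq_div_le_of_psi2Norm_le {μ : Measure ℝ} {K : ℝ}
    (hK : psi2Norm μ ≤ ENNReal.ofReal K) :
    ∫⁻ y, ENNReal.ofReal (Real.exp (y ^ 2 / (|K| + 1) ^ 2)) ∂μ ≤ 2 := by
  have h1 : psi2Norm μ < ENNReal.ofReal (|K| + 1) :=
    hK.trans_lt ((ENNReal.ofReal_lt_ofReal_iff (by positivity)).2 (by linarith [le_abs_self K]))
  simp only [psi2Norm, iInf_lt_iff] at h1
  obtain ⟨t, ht0, ht, htK⟩ := h1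
  have htK' : (t : ℝ) ≤ |K| + 1 := by
    rw [← ENNReal.ofReal_coe_nnreal] at htK
    exact ((ENNReal.ofReal_lt_ofReal_iff (by positivity)).1 htK).le
  have ht0' : (0 : ℝ) < t := ht0
  refine le_trans (lintegral_mono fun y => ENNReal.ofReal_le_ofReal (Real.exp_le_exp.2 ?_)) ht
  gcongr

theorem IsStdSubgaussian.integrable_exp_sq_div {K : ℝ} {μ : Measure ℝ} (h : IsStdSubgaussian K μ) :
    Integrable (fun y => Real.exp (y ^ 2 / (|K| + 1) ^ 2)) μ ∧
      ∫ y, Real.exp (y ^ 2 / (|K| + 1) ^ 2) ∂μ ≤ 2 :=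
  integrable_and_integral_le_of_lintegral_ofReal_le (by fun_prop) (fun _ => (Real.exp_pos _).le)
    (by norm_num) (by simpa using lintegral_exp_sq_div_le_of_psi2Norm_le h.psi2Norm_le)

/-- A centred law with bounded `ψ₂` norm has a subgaussian moment generating function: small
arguments use the vanishing mean, large ones `s y ≤ (s k)² + (y / k)²`. -/
theorem IsStdSubgaussian.hasSubgaussianMGF {K : ℝ} {μ : Measure ℝ} (h : IsStdSubgaussian K μ) :
    HasSubgaussianMGF id ⟨96 * (|K| + 1) ^ 2, by positivity⟩ μ := by
  have := h.isProbabilityMeasure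
  obtain ⟨hi, hle⟩ := h.integrable_exp_sq_div
  set k := |K| + 1
  have hk : 0 < k := by positivity
  have hpt : ∀ y : ℝ, Real.exp (|y| / k) ≤ Real.exp 1 * Real.exp (y ^ 2 / k ^ 2) := by
    intro y
    rw [← Real.exp_add, Real.exp_le_exp, ← sq_abs y, ← div_pow]
    nlinarith [sq_nonneg (|y| / k - 1)]
  have hint : Integrable (fun y => Real.exp (|y| / k)) μ := by
    refine (hi.const_mul (Real.exp 1)).mono' (by fun_prop) (ae_of_all _ fun y => ?_)
    rw [Real.norm_eq_abs, abs_of_pos (Real.exp_pos _)]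
    exact hpt y
  have hA : ∫ y, Real.exp (|y| / k) ∂μ ≤ 6 := by
    refine (integral_mono hint (hi.const_mul _) hpt).trans ?_
    rw [integral_const_mul]
    nlinarith [Real.exp_one_lt_d9, Real.exp_pos 1]
  have hcase : ∀ s : ℝ, Integrable (fun y => Real.exp (s * id y)) μ ∧
      mgf id μ s ≤ Real.exp (48 * k ^ 2 * s ^ 2) := by
    intro s
    rcases le_or_gt (|s| * k) (1 / 2) with hs | hs
    · obtain ⟨h1, h2⟩ := integrable_exp_mul_and_mgf_le (P := μ) measurable_id hk hint hA
        h.mean_eq_zero hs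
      exact ⟨h1, h2.trans (le_of_eq (by ring_nf))⟩
    · have hpt2 : ∀ y : ℝ, Real.exp (s * y) ≤
          Real.exp (s ^ 2 * k ^ 2) * Real.exp (y ^ 2 / k ^ 2) := by
        intro y
        rw [← Real.exp_add, Real.exp_le_exp, ← div_pow]
        have e : s * y = (s * k) * (y / k) := by field_simp
        rw [e, ← mul_pow]
        nlinarith [sq_nonneg (s * k - y / k), sq_nonneg (s * k), sq_nonneg (y / k)]
      have h1 : Integrable (fun y => Real.exp (s * id y)) μ := by
        refine (hi.const_mul (Real.exp (s ^ 2 * k ^ 2))).mono' (by fun_prop)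
          (ae_of_all _ fun y => ?_)
        rw [Real.norm_eq_abs, abs_of_pos (Real.exp_pos _)]
        exact hpt2 y
      refine ⟨h1, (integral_mono h1 (hi.const_mul _) hpt2).trans ?_⟩
      rw [integral_const_mul]
      have h3 : (1 : ℝ) / 4 ≤ s ^ 2 * k ^ 2 := by
        rw [← sq_abs s, ← mul_pow]
        nlinarith
      have h4 : (2 : ℝ) ≤ Real.exp 1 := by linarith [Real.exp_one_gt_d9]
      calc Real.exp (s ^ 2 * k ^ 2) * ∫ y, Real.exp (y ^ 2 / k ^ 2) ∂μ
          ≤ Real.exp (s ^ 2 * k ^ 2) * Real.exp 1 :=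
            mul_le_mul_of_nonneg_left (hle.trans h4) (Real.exp_pos _).le
        _ ≤ _ := by
            rw [← Real.exp_add, Real.exp_le_exp]
            linarith
  refine ⟨fun s => (hcase s).1, fun s => (hcase s).2.trans (le_of_eq ?_)⟩
  congr 1
  change _ = 96 * k ^ 2 * s ^ 2 / 2
  ring

theorem IsStdSubgaussian.measure_abs_ge_le {K : ℝ} {μ : Measure ℝ} (h : IsStdSubgaussian K μ)
    {T : ℝ} (hT : 0 ≤ T) :
    μ.real {y | T ≤ |y|} ≤ 2 * Real.exp (-(T ^ 2 / (|K| + 1) ^ 2)) := by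
  have := h.isProbabilityMeasure
  obtain ⟨hi, hle⟩ := h.integrable_exp_sq_div
  have h1 := mul_meas_ge_le_integral_of_nonneg
    (ae_of_all μ fun y => (Real.exp_pos (y ^ 2 / (|K| + 1) ^ 2)).le) hi
    (Real.exp (T ^ 2 / (|K| + 1) ^ 2))
  have h2 : {y : ℝ | T ≤ |y|} ⊆
      {y | Real.exp (T ^ 2 / (|K| + 1) ^ 2) ≤ Real.exp (y ^ 2 / (|K| + 1) ^ 2)} := by
    intro y hy
    rw [mem_ofPred_eq, Real.exp_le_exp, ← sq_abs y]
    have hy' : T ≤ |y| := hy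
    gcongr
  have h3 := measureReal_mono (μ := μ) h2
  rw [Real.exp_neg, ← div_eq_mul_inv, le_div_iff₀ (Real.exp_pos _)]
  nlinarith [Real.exp_pos (T ^ 2 / (|K| + 1) ^ 2)]

end Subgaussian

/-- Independent `σ`-algebras remain independent after grouping them over disjoint blocks of
indices. -/
theorem iIndep_iSup_of_pairwise_disjoint {Ω ι κ : Type*} [MeasurableSpace Ω] {P : Measure Ω}
    [IsProbabilityMeasure P] {m : ι → MeasurableSpace Ω} (hle : ∀ i, m i ≤ ‹MeasurableSpace Ω›)
    (hm : iIndep m P) {S : κ → Set ι} (hS : Pairwise (Function.onFun Disjoint S)) :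
    iIndep (fun k => ⨆ i ∈ S k, m i) P := by
  classical
  rw [iIndep_iff]
  intro s
  induction s using Finset.induction_on with
  | empty => simp
  | insert k s hk ih =>
    intro f hf
    rw [Finset.set_biInter_insert, Finset.prod_insert hk,
      ← ih fun i hi => hf i (Finset.mem_insert_of_mem hi)]
    have hdisj : Disjoint (S k) (⋃ j ∈ s, S j) := by
      rw [disjoint_iUnion₂_right]
      exact fun j hj => hS fun h => hk (h ▸ hj)
    have hI := (Indep_iff _ _ P).1 (indep_iSup_of_disjoint hle hm hdisj)
    refine hI _ _ (hf k (Finset.mem_insert_self k s)) ?_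
    refine Finset.measurableSet_biInter _ fun j hj => ?_
    have hmono : (⨆ i ∈ S j, m i) ≤ ⨆ i ∈ ⋃ j ∈ s, S j, m i :=
      biSup_mono fun i hi => mem_biUnion (show j ∈ (s : Set κ) from hj) hi
    exact hmono _ (hf j (Finset.mem_insert_of_mem hj))

/-! ### Neurons at initialization -/

/-- The initial parameters `(a_ℓ, w_ℓ, b_ℓ)` of neuron `ℓ`. -/
def neuron {m d : ℕ} (ℓ : Fin m) (ω : ParamIdx (Fin m) d → ℝ) : ℝ × (Fin d → ℝ) × ℝ :=
  (ω (Sum.inl ℓ), fun j => ω (Sum.inr (Sum.inl (ℓ, j))), ω (Sum.inr (Sum.inr (Sum.inl ℓ))))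

/-- The contribution of a neuron with parameters `p = (a, w, b)` to the tangent kernel, without the
normalization by the width. -/
def neuronKernel (σ : ℝ → ℝ) {d : ℕ} (x x' : EuclideanSpace ℝ (Fin d))
    (p : ℝ × (Fin d → ℝ) × ℝ) : ℝ :=
  σ (∑ j, p.2.1 j * x j + p.2.2) * σ (∑ j, p.2.1 j * x' j + p.2.2) +
    p.1 ^ 2 * (deriv σ (∑ j, p.2.1 j * x j + p.2.2) * deriv σ (∑ j, p.2.1 j * x' j + p.2.2)) *
      (inner ℝ x x' + 1)

/-- The two copies of each neuron contribute equally, which cancels the doubling of the width. -/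
theorem inner_gradNetwork_double (σ : ℝ → ℝ) {m d : ℕ} (ω : ParamIdx (Fin m) d → ℝ)
    (x x' : EuclideanSpace ℝ (Fin d)) :
    inner ℝ (gradNetwork σ (double ω) x) (gradNetwork σ (double ω) x') =
      1 / (m : ℝ) * ∑ ℓ, neuronKernel σ x x' (neuron ℓ ω) + 1 := by
  rw [inner_gradNetwork, Fintype.sum_sum_type]
  have h1 : ∀ ℓ : Fin m, ∀ x, preact (double ω) x (Sum.inl ℓ) =
      ∑ j, (neuron ℓ ω).2.1 j * x j + (neuron ℓ ω).2.2 := fun ℓ x => rfl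
  have h2 : ∀ ℓ : Fin m, ∀ x, preact (double ω) x (Sum.inr ℓ) =
      ∑ j, (neuron ℓ ω).2.1 j * x j + (neuron ℓ ω).2.2 := fun ℓ x => rfl
  have h3 : ∀ ℓ : Fin m, outer (double ω) (Sum.inl ℓ) = (neuron ℓ ω).1 := fun ℓ => rfl
  have h4 : ∀ ℓ : Fin m, outer (double ω) (Sum.inr ℓ) = -(neuron ℓ ω).1 := fun ℓ => rfl
  simp only [h1, h2, h3, h4, neg_sq, Fintype.card_sum, Fintype.card_fin, Nat.cast_add]
  congr 1
  change 1 / ((m : ℝ) + m) * (∑ ℓ, neuronKernel σ x x' (neuron ℓ ω) +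
    ∑ ℓ, neuronKernel σ x x' (neuron ℓ ω)) = _
  rcases Nat.eq_zero_or_pos m with rfl | hm
  · simp
  · field_simp

theorem network_double (σ : ℝ → ℝ) {m d : ℕ} (ω : ParamIdx (Fin m) d → ℝ)
    (x : EuclideanSpace ℝ (Fin d)) : network σ (double ω) x = 0 := by
  have h1 : ∀ ℓ : Fin m, outer (double ω) (Sum.inr ℓ) = -outer (double ω) (Sum.inl ℓ) :=
    fun ℓ => rfl
  have h2 : ∀ (ℓ : Fin m) j, weight (double ω) (Sum.inr ℓ) j = weight (double ω) (Sum.inl ℓ) j :=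
    fun ℓ j => rfl
  have h3 : ∀ ℓ : Fin m, bias (double ω) (Sum.inr ℓ) = bias (double ω) (Sum.inl ℓ) := fun ℓ => rfl
  have h4 : outerBias (double ω) = 0 := rfl
  simp [network, Fintype.sum_sum_type, h1, h2, h3, h4]

section Law

variable {K : ℝ} {𝒜 𝒲 ℬ ℬ' : Measure ℝ} {m d : ℕ}

theorem isStdSubgaussian_coordLaw (h𝒜 : IsStdSubgaussian K 𝒜) (h𝒲 : IsStdSubgaussian K 𝒲)
    (hℬ : IsStdSubgaussian K ℬ) (hℬ' : IsStdSubgaussian K ℬ') (i : ParamIdx (Fin m) d) :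
    IsStdSubgaussian K (coordLaw 𝒜 𝒲 ℬ ℬ' m d i) := by
  rcases i with ℓ | ⟨ℓ, j⟩ | ℓ | u <;> assumption

theorem iIndepFun_coord (hμ : ∀ i, IsProbabilityMeasure (coordLaw 𝒜 𝒲 ℬ ℬ' m d i)) :
    iIndepFun (fun i (ω : ParamIdx (Fin m) d → ℝ) => ω i) (initLaw 𝒜 𝒲 ℬ ℬ' m d) :=
  iIndepFun_pi (X := fun _ => id) (fun _ => aemeasurable_id)

theorem iIndepFun_neuron (hμ : ∀ i, IsProbabilityMeasure (coordLaw 𝒜 𝒲 ℬ ℬ' m d i)) :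
    iIndepFun (fun ℓ : Fin m => neuron ℓ) (initLaw 𝒜 𝒲 ℬ ℬ' m d) := by
  have : IsProbabilityMeasure (initLaw 𝒜 𝒲 ℬ ℬ' m d) := by unfold initLaw; infer_instance
  let S : Fin m → Set (ParamIdx (Fin m) d) := fun ℓ =>
    {i | i = Sum.inl ℓ ∨ (∃ j, i = Sum.inr (Sum.inl (ℓ, j))) ∨ i = Sum.inr (Sum.inr (Sum.inl ℓ))}
  have hS : Pairwise (Function.onFun Disjoint S) := by
    intro k ℓ hkℓ
    rw [Function.onFun, Set.disjoint_left]
    rintro i (rfl | ⟨j, rfl⟩ | rfl) h <;> simp_all [S]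
  have h := iIndep_iSup_of_pairwise_disjoint (fun i => (measurable_pi_apply i).comap_le)
    ((iIndepFun_iff_iIndep _ _ _).1 (iIndepFun_coord hμ)) hS
  rw [iIndepFun_iff_iIndep]
  refine (iIndep_iff _ _).2 fun s f hf => (iIndep_iff _ _).1 h s fun ℓ hℓ => ?_
  refine measurable_iff_comap_le.1 ?_ _ (hf ℓ hℓ)
  have hc : ∀ i ∈ S ℓ, Measurable[⨆ i ∈ S ℓ, MeasurableSpace.comap
      (fun ω : ParamIdx (Fin m) d → ℝ => ω i) inferInstance]
        (fun ω : ParamIdx (Fin m) d → ℝ => ω i) := fun i hi =>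
    (comap_measurable (fun ω : ParamIdx (Fin m) d → ℝ => ω i)).mono
      (le_biSup (fun i => MeasurableSpace.comap
        (fun ω : ParamIdx (Fin m) d → ℝ => ω i) inferInstance) hi) le_rfl
  refine Measurable.prodMk (hc _ (Or.inl rfl)) (Measurable.prodMk ?_ (hc _ (Or.inr (Or.inr rfl))))
  exact @measurable_pi_lambda _ _ _ (_) _ _ fun j => hc _ (Or.inr (Or.inl ⟨j, rfl⟩))

theorem measurable_neuron (ℓ : Fin m) :
    Measurable (neuron ℓ : (ParamIdx (Fin m) d → ℝ) → ℝ × (Fin d → ℝ) × ℝ) := by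
  unfold neuron
  fun_prop

theorem measurable_neuronKernel {σ : ℝ → ℝ} (hσ : Measurable σ) (x x' : EuclideanSpace ℝ (Fin d)) :
    Measurable (neuronKernel σ x x') := by
  have := measurable_deriv σ
  unfold neuronKernel
  fun_prop

theorem hasSubgaussianMGF_coord (hμ : ∀ i, IsStdSubgaussian K (coordLaw 𝒜 𝒲 ℬ ℬ' m d i))
    (i : ParamIdx (Fin m) d) :
    HasSubgaussianMGF (fun ω : ParamIdx (Fin m) d → ℝ => ω i)
      ⟨96 * (|K| + 1) ^ 2, by positivity⟩ (initLaw 𝒜 𝒲 ℬ ℬ' m d) := by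
  have := fun i => (hμ i).isProbabilityMeasure
  have h := (hμ i).hasSubgaussianMGF
  have hmap := (measurePreserving_eval (coordLaw 𝒜 𝒲 ℬ ℬ' m d) i).map_eq
  rw [← hmap] at h
  have h2 := (HasSubgaussianMGF.id_map_iff (μ := Measure.pi (coordLaw 𝒜 𝒲 ℬ ℬ' m d))
    (X := Function.eval i) (c := ⟨96 * (|K| + 1) ^ 2, by positivity⟩)
    (measurable_pi_apply i).aemeasurable).1
  exact h2 h

/-- The variance proxy of the preactivation at `x` depends on `‖x‖` but not on the dimension. -/
theorem exists_hasSubgaussianMGF_preact (hμ : ∀ i, IsStdSubgaussian K (coordLaw 𝒜 𝒲 ℬ ℬ' m d i))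
    (x : EuclideanSpace ℝ (Fin d)) (ℓ : Fin m) :
    ∃ c : ℝ≥0, (c : ℝ) = 96 * (|K| + 1) ^ 2 * (‖x‖ ^ 2 + 1) ∧
      HasSubgaussianMGF (fun ω => ∑ j, (neuron ℓ ω).2.1 j * x j + (neuron ℓ ω).2.2) c
        (initLaw 𝒜 𝒲 ℬ ℬ' m d) := by
  have hp := fun i => (hμ i).isProbabilityMeasure
  let e : Fin d ⊕ Unit → ParamIdx (Fin m) d :=
    Sum.elim (fun j => Sum.inr (Sum.inl (ℓ, j))) (fun _ => Sum.inr (Sum.inr (Sum.inl ℓ)))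
  have he : Function.Injective e := by
    rintro (i | i) (j | j) h <;> simp_all [e]
  let v : Fin d ⊕ Unit → ℝ := Sum.elim (fun j => x j) (fun _ => 1)
  have hind : iIndepFun (fun i (ω : ParamIdx (Fin m) d → ℝ) => v i * ω (e i))
      (initLaw 𝒜 𝒲 ℬ ℬ' m d) :=
    ((iIndepFun_coord hp).precomp he).comp (fun i y => v i * y) (fun i => by fun_prop)
  have h := HasSubgaussianMGF.sum_of_iIndepFun hind (s := Finset.univ)
    fun i _ => (hasSubgaussianMGF_coord hμ (e i)).const_mul (v i)
  refine ⟨_, ?_, h.congr (ae_of_all _ fun ω => ?_)⟩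
  · rw [NNReal.coe_sum, EuclideanSpace.real_norm_sq_eq]
    calc _ = ∑ i, v i ^ 2 * (96 * (|K| + 1) ^ 2) := rfl
      _ = _ := by
        rw [← Finset.sum_mul, Fintype.sum_sum_type]
        simp [v, mul_comm]
  · simp [v, e, Fintype.sum_sum_type, neuron, mul_comm]

end Law

/-! ### Concentration of the tangent kernel at initialization -/

/-- The scale `τ` at which the neuron kernels have a bounded exponential moment. It does not depend
on the input dimension. -/
def kernelScale (M K s₀ s₁ : ℝ) : ℝ :=
  12 * (2 * s₀ ^ 2 + s₁ ^ 2 * (M ^ 2 + 1) + 1) * (96 * (|K| + 1) ^ 2) * (M ^ 2 + 1)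

theorem one_le_kernelScale (M K s₀ s₁ : ℝ) : 1 ≤ kernelScale M K s₀ s₁ := by
  have h1 : 1 ≤ 2 * s₀ ^ 2 + s₁ ^ 2 * (M ^ 2 + 1) + 1 := by
    have : 0 ≤ 2 * s₀ ^ 2 + s₁ ^ 2 * (M ^ 2 + 1) := by positivity
    linarith
  have h2 : 1 ≤ (|K| + 1) ^ 2 := by nlinarith [abs_nonneg K]
  have h3 : 1 ≤ M ^ 2 + 1 := by nlinarith [sq_nonneg M]
  unfold kernelScale
  have h4 := one_le_mul_of_one_le_of_one_le h1 (one_le_mul_of_one_le_of_one_le h2 h3)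
  nlinarith

theorem exp_add_add_le (u v w : ℝ) :
    Real.exp (u + v + w) ≤ (Real.exp (3 * u) + Real.exp (3 * v) + Real.exp (3 * w)) / 3 := by
  have h : ∀ u : ℝ, Real.exp (3 * u) = Real.exp u ^ 3 := fun u => by
    rw [← Real.exp_nat_mul]; norm_num
  rw [h, h, h, Real.exp_add, Real.exp_add]
  set x := Real.exp u
  set y := Real.exp v
  set z := Real.exp w
  have hx : 0 < x := Real.exp_pos u
  have hy : 0 < y := Real.exp_pos v
  have hz : 0 < z := Real.exp_pos w
  have e : (x ^ 3 + y ^ 3 + z ^ 3) / 3 - x * y * z =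
      (x + y + z) * ((x - y) ^ 2 + (y - z) ^ 2 + (z - x) ^ 2) / 6 := by ring
  have : 0 ≤ (x + y + z) * ((x - y) ^ 2 + (y - z) ^ 2 + (z - x) ^ 2) / 6 := by positivity
  linarith

/-- Neuron kernels grow at most quadratically in the two preactivations and the outer weight. -/
theorem abs_neuronKernel_le {σ : ℝ → ℝ} {s₀ s₁ M : ℝ} (hσ : Differentiable ℝ σ) (h0 : |σ 0| ≤ s₀)
    (h1 : ∀ z, |deriv σ z| ≤ s₁) {d : ℕ} {x x' : EuclideanSpace ℝ (Fin d)} (hx : ‖x‖ ≤ M)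
    (hx' : ‖x'‖ ≤ M) (p : ℝ × (Fin d → ℝ) × ℝ) :
    |neuronKernel σ x x' p| ≤ (2 * s₀ ^ 2 + s₁ ^ 2 * (M ^ 2 + 1) + 1) *
      (1 + ((∑ j, p.2.1 j * x j + p.2.2) ^ 2 + (∑ j, p.2.1 j * x' j + p.2.2) ^ 2 + p.1 ^ 2)) := by
  have hs : ∀ z, |σ z| ≤ s₀ + s₁ * |z| := by
    intro z
    have h2 := convex_univ.norm_image_sub_le_of_norm_deriv_le (fun z _ => hσ z)
      (fun z _ => h1 z) (mem_univ 0) (mem_univ z)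
    rw [Real.norm_eq_abs, Real.norm_eq_abs, sub_zero] at h2
    have := abs_sub_abs_le_abs_sub (σ z) (σ 0)
    linarith
  have hs1 : 0 ≤ s₁ := (abs_nonneg _).trans (h1 0)
  have hs0 : 0 ≤ s₀ := (abs_nonneg _).trans h0
  unfold neuronKernel
  set z := ∑ j, p.2.1 j * x j + p.2.2
  set z' := ∑ j, p.2.1 j * x' j + p.2.2
  have e1 : |σ z * σ z'| ≤ 2 * s₀ ^ 2 + s₁ ^ 2 * (z ^ 2 + z' ^ 2) := by
    rw [abs_mul]
    refine (mul_le_mul (hs z) (hs z') (abs_nonneg _) (by positivity)).trans ?_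
    nlinarith [sq_nonneg (s₁ * |z| - s₁ * |z'|), sq_nonneg (s₀ - s₁ * |z|),
      sq_nonneg (s₀ - s₁ * |z'|), sq_abs z, sq_abs z']
  have e2 : |p.1 ^ 2 * (deriv σ z * deriv σ z') * (inner ℝ x x' + 1)| ≤
      p.1 ^ 2 * (s₁ * s₁) * (M ^ 2 + 1) := by
    rw [abs_mul, abs_mul, abs_mul, abs_of_nonneg (sq_nonneg p.1)]
    have hM : 0 ≤ M := (norm_nonneg _).trans hx
    have e3 : |(inner ℝ x x' : ℝ) + 1| ≤ M ^ 2 + 1 := by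
      refine (abs_add_le _ _).trans ?_
      have := (abs_real_inner_le_norm x x').trans (mul_le_mul hx hx' (norm_nonneg _) hM)
      rw [abs_one]
      nlinarith
    have := h1 z
    have := h1 z'
    gcongr
  refine (abs_add_le _ _).trans ((add_le_add e1 e2).trans ?_)
  have f1 : 0 ≤ z ^ 2 + z' ^ 2 := by positivity
  have f2 : 0 ≤ p.1 ^ 2 := sq_nonneg _
  have f3 : 0 ≤ s₁ ^ 2 * M ^ 2 := by positivity
  have f4 : 0 ≤ s₀ ^ 2 := sq_nonneg _
  have f5 : 0 ≤ s₁ ^ 2 := sq_nonneg _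
  nlinarith [mul_nonneg f1 f3, mul_nonneg f4 f1, mul_nonneg f4 f2, mul_nonneg f5 f1,
    mul_nonneg f5 f2, mul_nonneg f3 f2]

section Concentration

variable {K : ℝ} {𝒜 𝒲 ℬ ℬ' : Measure ℝ} {m d : ℕ} {σ : ℝ → ℝ} {s₀ s₁ M : ℝ}

theorem isProbabilityMeasure_initLaw
    (hμ : ∀ i, IsStdSubgaussian K (coordLaw 𝒜 𝒲 ℬ ℬ' m d i)) :
    IsProbabilityMeasure (initLaw 𝒜 𝒲 ℬ ℬ' m d) := by
  have := fun i => (hμ i).isProbabilityMeasure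
  unfold initLaw
  infer_instance

/-- Neuron kernels are subexponential at the scale `kernelScale`: they are dominated by squares of
three subgaussian variables, separated by the inequality of arithmetic and geometric means. -/
theorem integrable_exp_abs_neuronKernel_div
    (hμ : ∀ i, IsStdSubgaussian K (coordLaw 𝒜 𝒲 ℬ ℬ' m d i)) (hσ : Differentiable ℝ σ)
    (h0 : |σ 0| ≤ s₀) (h1 : ∀ z, |deriv σ z| ≤ s₁) {x x' : EuclideanSpace ℝ (Fin d)}
    (hx : ‖x‖ ≤ M) (hx' : ‖x'‖ ≤ M) (ℓ : Fin m) :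
    Integrable (fun ω => Real.exp (|neuronKernel σ x x' (neuron ℓ ω)| / kernelScale M K s₀ s₁))
      (initLaw 𝒜 𝒲 ℬ ℬ' m d) ∧
    ∫ ω, Real.exp (|neuronKernel σ x x' (neuron ℓ ω)| / kernelScale M K s₀ s₁)
      ∂(initLaw 𝒜 𝒲 ℬ ℬ' m d) ≤ 6 := by
  have hP := isProbabilityMeasure_initLaw hμ
  have hM : 0 ≤ M := (norm_nonneg _).trans hx
  set τ := kernelScale M K s₀ s₁ with hτdef
  have hτ : 1 ≤ τ := one_le_kernelScale M K s₀ s₁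
  set S := 2 * s₀ ^ 2 + s₁ ^ 2 * (M ^ 2 + 1) + 1 with hS
  have hS0 : 0 < S := by positivity
  set k := 96 * (|K| + 1) ^ 2 with hk
  have hk1 : 1 ≤ k := by nlinarith [abs_nonneg K]
  have hτS : τ = 12 * S * k * (M ^ 2 + 1) := rfl
  have hsτ : ∀ c : ℝ, 0 ≤ c → c ≤ k * (M ^ 2 + 1) → c * (3 * (S / τ)) ≤ 1 / 4 := by
    intro c hc hck
    rw [mul_div_assoc', mul_div_assoc', div_le_iff₀ (by linarith), hτS]
    nlinarith [mul_le_mul_of_nonneg_left hck hS0.le]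
  have hs0 : 0 ≤ 3 * (S / τ) := by positivity
  -- exponential moments of the squares of the two preactivations and of the outer weight
  have hmom : ∀ x : EuclideanSpace ℝ (Fin d), ‖x‖ ≤ M → Integrable (fun ω => Real.exp
      (3 * (S / τ) * (∑ j, (neuron ℓ ω).2.1 j * x j + (neuron ℓ ω).2.2) ^ 2))
        (initLaw 𝒜 𝒲 ℬ ℬ' m d) ∧ ∫ ω, Real.exp
      (3 * (S / τ) * (∑ j, (neuron ℓ ω).2.1 j * x j + (neuron ℓ ω).2.2) ^ 2)
        ∂(initLaw 𝒜 𝒲 ℬ ℬ' m d) ≤ 2 := by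
    intro x hx
    have hm := measurable_neuron (d := d) ℓ
    obtain ⟨c, hc, hsub⟩ := exists_hasSubgaussianMGF_preact hμ x ℓ
    refine integrable_and_integral_le_of_lintegral_ofReal_le (by fun_prop)
      (fun _ => (Real.exp_pos _).le) (by norm_num) ?_
    rw [ENNReal.ofReal_ofNat]
    refine hsub.lintegral_exp_mul_sq_le (by fun_prop) hs0 (hsτ c c.2 ?_)
    rw [hc]
    have := pow_le_pow_left₀ (norm_nonneg _) hx 2
    gcongr
  have hmom_a : Integrable (fun ω => Real.exp (3 * (S / τ) * (neuron ℓ ω).1 ^ 2))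
        (initLaw 𝒜 𝒲 ℬ ℬ' m d) ∧ ∫ ω, Real.exp (3 * (S / τ) * (neuron ℓ ω).1 ^ 2)
        ∂(initLaw 𝒜 𝒲 ℬ ℬ' m d) ≤ 2 := by
    have hm := measurable_neuron (d := d) ℓ
    refine integrable_and_integral_le_of_lintegral_ofReal_le (by fun_prop)
      (fun _ => (Real.exp_pos _).le) (by norm_num) ?_
    rw [ENNReal.ofReal_ofNat]
    refine (hasSubgaussianMGF_coord hμ (Sum.inl ℓ)).lintegral_exp_mul_sq_le (by fun_prop) hs0
      (hsτ k (by linarith) ?_)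
    nlinarith [sq_nonneg M]
  obtain ⟨i1, l1⟩ := hmom x hx
  obtain ⟨i2, l2⟩ := hmom x' hx'
  obtain ⟨i3, l3⟩ := hmom_a
  have hSτ : S / τ ≤ 1 := by
    rw [div_le_one (by linarith), hτS]
    have : 1 ≤ k * (M ^ 2 + 1) := one_le_mul_of_one_le_of_one_le hk1 (by nlinarith [sq_nonneg M])
    nlinarith
  have hpt : ∀ ω, Real.exp (|neuronKernel σ x x' (neuron ℓ ω)| / τ) ≤ Real.exp 1 / 3 *
      (Real.exp (3 * (S / τ) * (∑ j, (neuron ℓ ω).2.1 j * x j + (neuron ℓ ω).2.2) ^ 2) +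
      Real.exp (3 * (S / τ) * (∑ j, (neuron ℓ ω).2.1 j * x' j + (neuron ℓ ω).2.2) ^ 2) +
      Real.exp (3 * (S / τ) * (neuron ℓ ω).1 ^ 2)) := by
    intro ω
    have h2 := abs_neuronKernel_le hσ h0 h1 hx hx' (neuron ℓ ω)
    rw [← hS] at h2
    set z := ∑ j, (neuron ℓ ω).2.1 j * x j + (neuron ℓ ω).2.2
    set z' := ∑ j, (neuron ℓ ω).2.1 j * x' j + (neuron ℓ ω).2.2
    set a := (neuron ℓ ω).1
    have h3 : |neuronKernel σ x x' (neuron ℓ ω)| / τ ≤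
        1 + (S / τ * z ^ 2 + S / τ * z' ^ 2 + S / τ * a ^ 2) := by
      have e : S * (1 + (z ^ 2 + z' ^ 2 + a ^ 2)) / τ =
          S / τ + (S / τ * z ^ 2 + S / τ * z' ^ 2 + S / τ * a ^ 2) := by ring
      have := div_le_div_of_nonneg_right h2 (by linarith : 0 ≤ τ)
      linarith
    refine (Real.exp_le_exp.2 h3).trans ?_
    rw [Real.exp_add]
    refine (mul_le_mul_of_nonneg_left (exp_add_add_le _ _ _) (Real.exp_pos 1).le).trans
      (le_of_eq ?_)
    simp only [← mul_assoc]
    ring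
  have i12 : Integrable (fun ω =>
      Real.exp (3 * (S / τ) * (∑ j, (neuron ℓ ω).2.1 j * x j + (neuron ℓ ω).2.2) ^ 2) +
      Real.exp (3 * (S / τ) * (∑ j, (neuron ℓ ω).2.1 j * x' j + (neuron ℓ ω).2.2) ^ 2))
        (initLaw 𝒜 𝒲 ℬ ℬ' m d) := i1.add i2
  have hbound := (i12.add i3).const_mul (Real.exp 1 / 3)
  have hmeas : Measurable fun ω : ParamIdx (Fin m) d → ℝ => neuronKernel σ x x' (neuron ℓ ω) :=
    (measurable_neuronKernel hσ.continuous.measurable x x').comp (measurable_neuron ℓ)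
  have hint : Integrable (fun ω => Real.exp (|neuronKernel σ x x' (neuron ℓ ω)| / τ))
      (initLaw 𝒜 𝒲 ℬ ℬ' m d) := by
    refine hbound.mono' (hmeas.abs.div_const τ).exp.aestronglyMeasurable (ae_of_all _ fun ω => ?_)
    rw [Real.norm_eq_abs, abs_of_pos (Real.exp_pos _)]
    exact hpt ω
  refine ⟨hint, (integral_mono hint hbound hpt).trans ?_⟩
  simp only [Pi.add_apply]
  rw [integral_const_mul, integral_add i12 i3, integral_add i1 i2]
  nlinarith [Real.exp_one_lt_d9, Real.exp_pos 1]

theorem ntk_eq (hμ : ∀ i, IsStdSubgaussian K (coordLaw 𝒜 𝒲 ℬ ℬ' m d i))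
    (hσ : Differentiable ℝ σ)
    (h0 : |σ 0| ≤ s₀) (h1 : ∀ z, |deriv σ z| ≤ s₁) {x x' : EuclideanSpace ℝ (Fin d)}
    (hx : ‖x‖ ≤ M) (hx' : ‖x'‖ ≤ M) :
    ntk σ 𝒜 𝒲 ℬ ℬ' m x x' = 1 / (m : ℝ) * ∑ ℓ : Fin m,
      ∫ ω, neuronKernel σ x x' (neuron ℓ ω) ∂(initLaw 𝒜 𝒲 ℬ ℬ' m d) + 1 := by
  have hP := isProbabilityMeasure_initLaw hμ
  have hint : ∀ ℓ : Fin m, Integrable (fun ω => neuronKernel σ x x' (neuron ℓ ω))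
      (initLaw 𝒜 𝒲 ℬ ℬ' m d) := fun ℓ =>
    integrable_of_integrable_exp_abs_div
      ((measurable_neuronKernel hσ.continuous.measurable x x').comp (measurable_neuron ℓ))
      (zero_lt_one.trans_le (one_le_kernelScale M K s₀ s₁))
      (integrable_exp_abs_neuronKernel_div hμ hσ h0 h1 hx hx' ℓ).1
  unfold ntk
  simp only [(hasGradientAt_network hσ _ _).gradient, inner_gradNetwork_double]
  rw [integral_add ((integrable_finsetSum _ fun ℓ _ => hint ℓ).const_mul _) (integrable_const 1),
    integral_const_mul, integral_finsetSum _ fun ℓ _ => hint ℓ]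
  simp

theorem abs_ntk_le (hμ : ∀ i, IsStdSubgaussian K (coordLaw 𝒜 𝒲 ℬ ℬ' m d i))
    (hσ : Differentiable ℝ σ)
    (h0 : |σ 0| ≤ s₀) (h1 : ∀ z, |deriv σ z| ≤ s₁) {x x' : EuclideanSpace ℝ (Fin d)}
    (hx : ‖x‖ ≤ M) (hx' : ‖x'‖ ≤ M) :
    |ntk σ 𝒜 𝒲 ℬ ℬ' m x x'| ≤ 7 * kernelScale M K s₀ s₁ := by
  have hP := isProbabilityMeasure_initLaw hμ
  have hτ := one_le_kernelScale M K s₀ s₁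
  rw [ntk_eq hμ hσ h0 h1 hx hx']
  have hE : ∀ ℓ : Fin m, |∫ ω, neuronKernel σ x x' (neuron ℓ ω) ∂(initLaw 𝒜 𝒲 ℬ ℬ' m d)| ≤
      kernelScale M K s₀ s₁ * 6 := fun ℓ =>
    abs_integral_le_of_integral_exp_abs_div_le (by linarith)
      (integrable_exp_abs_neuronKernel_div hμ hσ h0 h1 hx hx' ℓ).1
      (integrable_exp_abs_neuronKernel_div hμ hσ h0 h1 hx hx' ℓ).2
  have hsum : |∑ ℓ : Fin m, ∫ ω, neuronKernel σ x x' (neuron ℓ ω) ∂(initLaw 𝒜 𝒲 ℬ ℬ' m d)| ≤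
      m * (kernelScale M K s₀ s₁ * 6) := by
    refine (Finset.abs_sum_le_sum_abs _ _).trans
      ((Finset.sum_le_sum fun ℓ _ => hE ℓ).trans (le_of_eq (by simp)))
  refine (abs_add_le _ _).trans ?_
  rw [abs_mul, abs_one, abs_of_nonneg (by positivity : 0 ≤ 1 / (m : ℝ))]
  have h3 : 1 / (m : ℝ) * |∑ ℓ : Fin m, ∫ ω, neuronKernel σ x x' (neuron ℓ ω)
      ∂(initLaw 𝒜 𝒲 ℬ ℬ' m d)| ≤ kernelScale M K s₀ s₁ * 6 := by
    rcases Nat.eq_zero_or_pos m with rfl | hm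
    · simp; linarith
    · have hm' : (0 : ℝ) < m := by exact_mod_cast hm
      rw [one_div, inv_mul_le_iff₀ hm']
      exact hsum
  linarith

theorem measure_abs_inner_sub_ntk_ge_le (hm : 0 < m)
    (hμ : ∀ i, IsStdSubgaussian K (coordLaw 𝒜 𝒲 ℬ ℬ' m d i)) (hσ : Differentiable ℝ σ)
    (h0 : |σ 0| ≤ s₀) (h1 : ∀ z, |deriv σ z| ≤ s₁) {x x' : EuclideanSpace ℝ (Fin d)}
    (hx : ‖x‖ ≤ M) (hx' : ‖x'‖ ≤ M) {η : ℝ} (hη0 : 0 ≤ η) (hη : η ≤ 48 * kernelScale M K s₀ s₁) :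
    (initLaw 𝒜 𝒲 ℬ ℬ' m d).real {ω | η ≤ |inner ℝ (gradNetwork σ (double ω) x)
      (gradNetwork σ (double ω) x') - ntk σ 𝒜 𝒲 ℬ ℬ' m x x'|} ≤
        2 * Real.exp (-(m * η ^ 2 / (32 * (6 * Real.exp 6) * kernelScale M K s₀ s₁ ^ 2))) := by
  have hP := isProbabilityMeasure_initLaw hμ
  have hτ := one_le_kernelScale M K s₀ s₁
  have hm' : (0 : ℝ) < m := by exact_mod_cast hm
  have hmeas := measurable_neuronKernel hσ.continuous.measurable x x'
  have hind : iIndepFun (fun (ℓ : Fin m) ω => neuronKernel σ x x' (neuron ℓ ω))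
      (initLaw 𝒜 𝒲 ℬ ℬ' m d) :=
    (iIndepFun_neuron fun i => (hμ i).isProbabilityMeasure).comp
      (fun _ => neuronKernel σ x x') (fun _ => hmeas)
  have hb := measure_abs_sum_sub_integral_ge_le (A := 6) (η := η) hind
    (fun ℓ => hmeas.comp (measurable_neuron ℓ)) (by linarith : 0 < kernelScale M K s₀ s₁)
    (by norm_num) (fun ℓ => (integrable_exp_abs_neuronKernel_div hμ hσ h0 h1 hx hx' ℓ).1)
    (fun ℓ => (integrable_exp_abs_neuronKernel_div hμ hσ h0 h1 hx hx' ℓ).2) hη0 (by linarith)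
  rw [Fintype.card_fin] at hb
  refine le_trans (measureReal_mono fun ω hω => ?_) hb
  have hω' : η ≤ |inner ℝ (gradNetwork σ (double ω) x)
      (gradNetwork σ (double ω) x') - ntk σ 𝒜 𝒲 ℬ ℬ' m x x'| := hω
  rw [ntk_eq hμ hσ h0 h1 hx hx', inner_gradNetwork_double, add_sub_add_right_eq_sub, ← mul_sub,
    ← Finset.sum_sub_distrib, abs_mul, abs_of_pos (by positivity : 0 < 1 / (m : ℝ)), one_div,
    le_inv_mul_iff₀ hm'] at hω'
  exact hω'

/-- With high probability the outer weights are bounded by `T` and the empirical tangent kernel is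
entrywise `η`-close to its mean. -/
theorem exists_initialization_event (hm : 0 < m)
    (hμ : ∀ i, IsStdSubgaussian K (coordLaw 𝒜 𝒲 ℬ ℬ' m d i)) (hσ : Differentiable ℝ σ)
    (h0 : |σ 0| ≤ s₀) (h1 : ∀ z, |deriv σ z| ≤ s₁) {n : ℕ} {x : Fin n → EuclideanSpace ℝ (Fin d)}
    (hx : ∀ i, ‖x i‖ ≤ M) {η T δ : ℝ} (hη0 : 0 ≤ η) (hη : η ≤ 48 * kernelScale M K s₀ s₁)
    (hT0 : 0 ≤ T) (hT : m * (2 * Real.exp (-(T ^ 2 / (|K| + 1) ^ 2))) ≤ δ / 2)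
    (hηδ : (n : ℝ) ^ 2 * (2 * Real.exp
      (-(m * η ^ 2 / (32 * (6 * Real.exp 6) * kernelScale M K s₀ s₁ ^ 2)))) ≤ δ / 2) :
    ∃ E : Set (ParamIdx (Fin m) d → ℝ), MeasurableSet E ∧
      ENNReal.ofReal (1 - δ) ≤ initLaw 𝒜 𝒲 ℬ ℬ' m d E ∧
      ∀ ω ∈ E, (∀ ℓ, |ω (Sum.inl ℓ)| ≤ T) ∧ ∀ i j,
        |inner ℝ (gradNetwork σ (double ω) (x i)) (gradNetwork σ (double ω) (x j)) -
          ntkGram σ 𝒜 𝒲 ℬ ℬ' m x i j| ≤ η := by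
  have hP := isProbabilityMeasure_initLaw hμ
  set P := initLaw 𝒜 𝒲 ℬ ℬ' m d with hPdef
  let B₁ : Fin m → Set (ParamIdx (Fin m) d → ℝ) := fun ℓ => {ω | T ≤ |ω (Sum.inl ℓ)|}
  let B₂ : Fin n × Fin n → Set (ParamIdx (Fin m) d → ℝ) := fun q =>
    {ω | η ≤ |inner ℝ (gradNetwork σ (double ω) (x q.1)) (gradNetwork σ (double ω) (x q.2)) -
          ntk σ 𝒜 𝒲 ℬ ℬ' m (x q.1) (x q.2)|}
  have hB₁ : P.real (⋃ ℓ, B₁ ℓ) ≤ δ / 2 := by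
    refine (measureReal_iUnion_fintype_le _).trans (le_trans ?_ hT)
    refine (Finset.sum_le_sum (g := fun _ => 2 * Real.exp (-(T ^ 2 / (|K| + 1) ^ 2)))
      fun ℓ _ => ?_).trans (le_of_eq (by simp))
    have hp := fun i => (hμ i).isProbabilityMeasure
    have hmap := (measurePreserving_eval (coordLaw 𝒜 𝒲 ℬ ℬ' m d) (Sum.inl ℓ))
    have hset : MeasurableSet {y : ℝ | T ≤ |y|} := measurableSet_le (by fun_prop) (by fun_prop)
    have := hmap.measureReal_preimage hset.nullMeasurableSet
    exact (le_of_eq this).trans ((hμ (Sum.inl ℓ)).measure_abs_ge_le hT0)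
  have hB₂ : P.real (⋃ q, B₂ q) ≤ δ / 2 := by
    refine (measureReal_iUnion_fintype_le _).trans (le_trans ?_ hηδ)
    refine (Finset.sum_le_sum fun q _ => measure_abs_inner_sub_ntk_ge_le hm hμ hσ h0 h1
      (hx q.1) (hx q.2) hη0 hη).trans (le_of_eq (by simp [pow_two]))
  -- a measurable hull replaces the bad event, which avoids proving its measurability
  set B := (⋃ ℓ, B₁ ℓ) ∪ ⋃ q, B₂ q with hB
  have hPB : P.real B ≤ δ := (measureReal_union_le _ _).trans (by linarith)
  refine ⟨(toMeasurable P B)ᶜ, (measurableSet_toMeasurable P B).compl, ?_, ?_⟩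
  · rw [prob_compl_eq_one_sub (measurableSet_toMeasurable P B), measure_toMeasurable,
      ENNReal.ofReal_sub _ ((measureReal_nonneg).trans hPB), ENNReal.ofReal_one]
    refine tsub_le_tsub_left ?_ 1
    rw [← ofReal_measureReal]
    exact ENNReal.ofReal_le_ofReal hPB
  · intro ω hω
    have hω' : ω ∉ B := fun h => hω (subset_toMeasurable P B h)
    have h₁ : ∀ ℓ, ω ∉ B₁ ℓ := fun ℓ h => hω' (Or.inl (mem_iUnion.2 ⟨ℓ, h⟩))
    have h₂ : ∀ q, ω ∉ B₂ q := fun q h => hω' (Or.inr (mem_iUnion.2 ⟨q, h⟩))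
    exact ⟨fun ℓ => (not_le.1 (h₁ ℓ)).le, fun i j => (not_le.1 (h₂ (i, j))).le⟩

end Concentration

/-! ### The network along the flow -/

section Loss

variable {ι : Type} [Fintype ι] {d n : ℕ} {σ : ℝ → ℝ} {x : Fin n → EuclideanSpace ℝ (Fin d)}
  {fstar : EuclideanSpace ℝ (Fin d) → ℝ}

theorem loss_eq_sum (θ : Param ι d) :
    loss σ x fstar θ = 1 / (2 * (n : ℝ)) * ∑ i, (network σ θ (x i) - fstar (x i)) ^ 2 := by
  rw [loss, EuclideanSpace.real_norm_sq_eq]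
  rfl

theorem loss_nonneg (θ : Param ι d) : 0 ≤ loss σ x fstar θ := by
  unfold loss
  positivity

theorem contDiff_loss (hσ : ContDiff ℝ 2 σ) :
    ContDiff ℝ 2 (loss σ x fstar : Param ι d → ℝ) := by
  have h : (loss σ x fstar : Param ι d → ℝ) = fun θ =>
      1 / (2 * (n : ℝ)) * ∑ i, (network σ θ (x i) - fstar (x i)) ^ 2 := funext loss_eq_sum
  rw [h]
  exact contDiff_const.mul (ContDiff.sum fun i _ =>
    ((contDiff_network hσ (x i)).sub contDiff_const).pow 2)

theorem gradient_loss (hσ : Differentiable ℝ σ) (θ : Param ι d) :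
    gradient (loss σ x fstar) θ =
      (1 / (n : ℝ)) • ∑ i, (network σ θ (x i) - fstar (x i)) • gradNetwork σ θ (x i) := by
  refine HasGradientAt.gradient ?_
  rw [hasGradientAt_iff_hasFDerivAt]
  have h : (loss σ x fstar : Param ι d → ℝ) = fun θ =>
      1 / (2 * (n : ℝ)) * ∑ i, (network σ θ (x i) - fstar (x i)) ^ 2 := funext loss_eq_sum
  rw [h]
  have h1 := (HasFDerivAt.fun_sum (u := Finset.univ) fun i _ =>
    ((hasGradientAt_network hσ θ (x i)).hasFDerivAt.sub_const (fstar (x i))).pow 2).const_mul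
      (1 / (2 * (n : ℝ)))
  refine h1.congr_fderiv ?_
  ext v
  simp [Finset.mul_sum]
  refine Finset.sum_congr rfl fun i _ => ?_
  ring

theorem IsGradientFlow.hasDerivWithinAt (hσ : Differentiable ℝ σ) {θ₀ : Param ι d}
    {θ : ℝ → Param ι d} (hθ : IsGradientFlow σ x fstar θ₀ θ) (t : ℝ) (ht : 0 ≤ t) :
    HasDerivWithinAt θ (-((1 / (n : ℝ)) • ∑ i, (network σ (θ t) (x i) - fstar (x i)) •
      gradNetwork σ (θ t) (x i))) (Ici 0) t := by
  rw [← gradient_loss hσ]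
  exact hθ.2 t ht

theorem continuous_gradNetwork (hσ : ContDiff ℝ 2 σ) (x : EuclideanSpace ℝ (Fin d)) :
    Continuous fun θ : Param ι d => gradNetwork σ θ x := by
  have h := (contDiff_gradient (contDiff_network (ι := ι) hσ x)).continuous
  rwa [gradient_eq fun θ => hasGradientAt_network (hσ.differentiable (by norm_num)) θ x] at h

theorem inner_gram_mulVec_nonneg {E : Type*} [NormedAddCommGroup E] [InnerProductSpace ℝ E]
    (v : Fin n → E) (w : EuclideanSpace ℝ (Fin n)) :
    0 ≤ (inner ℝ w (WithLp.toLp 2 (Matrix.gram ℝ v *ᵥ WithLp.ofLp w)) : ℝ) := by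
  have h : (inner ℝ w (WithLp.toLp 2 (Matrix.gram ℝ v *ᵥ WithLp.ofLp w)) : ℝ) =
      inner ℝ (∑ i, w i • v i) (∑ i, w i • v i) := by
    simp only [sum_inner, inner_sum, real_inner_smul_left, real_inner_smul_right, PiLp.inner_apply,
      Matrix.mulVec, dotProduct, Matrix.gram_apply, RCLike.inner_apply, conj_trivial,
      Finset.sum_mul]
    exact Finset.sum_congr rfl fun i _ => Finset.sum_congr rfl fun j _ => by
      rw [real_inner_comm (v i)]; ring
  rw [h]
  exact real_inner_self_nonneg

/-- The residual never grows along the gradient flow. -/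
theorem norm_residual_le (hn : 0 < n) (hσ : Differentiable ℝ σ) {θ₀ : Param ι d}
    {θ : ℝ → Param ι d} (hθ : IsGradientFlow σ x fstar θ₀ θ) {t : ℝ} (ht : 0 ≤ t) :
    ‖residual σ x fstar (θ t)‖ ≤ ‖residual σ x fstar θ₀‖ := by
  have h := norm_residual_le_exp (l := 0) (T := t) (f := fun i θ => network σ θ (x i))
    (g := fun i θ => gradNetwork σ θ (x i)) (y := fun i => fstar (x i)) hn
    (fun i θ => hasGradientAt_network hσ θ (x i)) (hθ.hasDerivWithinAt hσ)
    (fun s _ _ w => by simpa using inner_gram_mulVec_nonneg _ w) t ht le_rfl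
  rw [hθ.1] at h
  simpa [residual] using h

theorem residual_double {m : ℕ} (ω : ParamIdx (Fin m) d → ℝ) :
    residual σ x fstar (double ω) = -labels x fstar := by
  ext i
  simp [residual, labels, network_double]

theorem norm_labels_le {B : ℝ} (hn : 0 < n) (hB : ∀ i, |fstar (x i)| ≤ B) :
    ‖labels x fstar‖ ≤ B * √n := by
  have hB0 : 0 ≤ B := (abs_nonneg _).trans (hB ⟨0, hn⟩)
  refine le_of_sq_le_sq ?_ (by positivity)
  rw [mul_pow, Real.sq_sqrt (Nat.cast_nonneg _), EuclideanSpace.real_norm_sq_eq, mul_comm]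
  refine (Finset.sum_le_sum (g := fun _ => B ^ 2) fun i _ => ?_).trans (le_of_eq (by simp))
  exact sq_le_sq' (abs_le.1 (hB i)).1 (abs_le.1 (hB i)).2

end Loss

theorem exists_isGradientFlow {ι : Type} [Fintype ι] {d n : ℕ} {σ : ℝ → ℝ} (hσ : ContDiff ℝ 2 σ)
    (x : Fin n → EuclideanSpace ℝ (Fin d)) (fstar : EuclideanSpace ℝ (Fin d) → ℝ)
    (θ₀ : Param ι d) : ∃ θ : ℝ → Param ι d, IsGradientFlow σ x fstar θ₀ θ :=
  exists_gradientFlow (contDiff_loss hσ) loss_nonneg θ₀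

theorem abs_norm_sub_sqrt_le {n : ℕ} (hn : 0 < n) {G : Matrix (Fin n) (Fin n) ℝ}
    {r y : EuclideanSpace ℝ (Fin n)} {t ε : ℝ}
    (h : ‖r - WithLp.toLp 2 (NormedSpace.exp (-(t • G)) *ᵥ WithLp.ofLp (-y))‖ ≤ ε)
    {v : Fin n → EuclideanSpace ℝ (Fin n)} {lam : Fin n → ℝ} (hv : Orthonormal ℝ v)
    (hG : ∀ i, G *ᵥ WithLp.ofLp (v i) = lam i • WithLp.ofLp (v i)) :
    |‖r‖ - √(∑ i, Real.exp (-2 * lam i * t) * |inner ℝ y (v i)| ^ 2)| ≤ ε := by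
  have : Nonempty (Fin n) := ⟨⟨0, hn⟩⟩
  let b := (basisOfOrthonormalOfCardEqFinrank hv (by simp)).toOrthonormalBasis (by simpa using hv)
  have hb : ∀ i, b i = v i := fun i => by simp [b]
  have h1 := norm_sq_exp_neg_smul_mulVec b (lam := lam) (fun i => by rw [hb]; exact hG i) t (-y)
  simp only [hb, inner_neg_left, abs_neg] at h1
  rw [← h1, Real.sqrt_sq (norm_nonneg _)]
  exact (abs_norm_sub_norm_le _ _).trans h

/-! ### The tangent kernel regime -/

/-- A width condition with the logarithmic factor `L` in place of `log m` implies the one with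
`log m`: the tangent of the logarithm at `2 D X` bounds `D X log m` by `m / 2` plus a multiple of
`D X L`. -/
theorem mul_log_le_of_mul_le {D X L m : ℝ} (hD : 0 < D) (hX : 0 < X) (hL : 1 ≤ L)
    (hXL : Real.log X ≤ 5 * L) (hm : 2 * D * (8 + |Real.log (2 * D)|) * X * L ≤ m) :
    D * X * (3 * L + Real.log m) ≤ m := by
  have hm0 : 0 < m := lt_of_lt_of_le (by positivity) hm
  have hs : 0 < 2 * D * X := by positivity
  have h1 : Real.log m ≤ m / (2 * D * X) + (Real.log (2 * D) + Real.log X) := by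
    have h2 := Real.log_le_sub_one_of_pos (div_pos hm0 hs)
    rw [Real.log_div hm0.ne' hs.ne', Real.log_mul (by positivity) hX.ne'] at h2
    linarith
  have h3 : D * X * (m / (2 * D * X)) = m / 2 := by field_simp
  have h4 : Real.log (2 * D) ≤ |Real.log (2 * D)| * L :=
    (le_abs_self _).trans (le_mul_of_one_le_right (abs_nonneg _) hL)
  have h5 : D * X * (3 * L + Real.log m) ≤
      D * X * (3 * L + (m / (2 * D * X) + (|Real.log (2 * D)| * L + 5 * L))) := by
    refine mul_le_mul_of_nonneg_left ?_ (by positivity)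
    linarith
  have h6 : D * X * (3 * L + (m / (2 * D * X) + (|Real.log (2 * D)| * L + 5 * L))) =
      D * X * (m / (2 * D * X)) + (8 + |Real.log (2 * D)|) * D * X * L := by ring
  rw [h6, h3] at h5
  linarith

theorem one_le_logFactor (d n : ℕ) {ε lam δ : ℝ} (hδ : 0 < δ)
    (hδ1 : δ < 1) : 1 ≤ logFactor d n ε lam δ := by
  have h1 : 0 ≤ Real.log d := Real.log_natCast_nonneg d
  have h2 : 0 ≤ Real.log n := Real.log_natCast_nonneg n
  have h3 : 0 ≤ Real.log (1 / δ) := Real.log_nonneg (by rw [le_div_iff₀ hδ]; linarith)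
  have h4 := Real.posLog_nonneg (x := 1 / ε)
  have h5 := Real.posLog_nonneg (x := 1 / lam)
  unfold logFactor
  linarith

theorem log_width_le_logFactor {d n : ℕ} (hd : 1 ≤ d) (hn : 1 ≤ n) {ε lam δ : ℝ} (hε : 0 < ε)
    (hlam : 0 < lam) (hδ : 0 < δ) (hδ1 : δ < 1) :
    Real.log (d * (n : ℝ) ^ 5 / (ε ^ 2 * lam ^ 4)) ≤ 5 * logFactor d n ε lam δ := by
  have hd' : (0 : ℝ) < d := by exact_mod_cast hd
  have hn' : (0 : ℝ) < n := by exact_mod_cast hn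
  have h1 : 0 ≤ Real.log d := Real.log_natCast_nonneg d
  have h2 : 0 ≤ Real.log n := Real.log_natCast_nonneg n
  have h3 : 0 ≤ Real.log (1 / δ) := Real.log_nonneg (by rw [le_div_iff₀ hδ]; linarith)
  have h4 := Real.posLog_nonneg (x := 1 / ε)
  have h5 := Real.posLog_nonneg (x := 1 / lam)
  have h6 : -Real.log ε ≤ Real.posLog (1 / ε) := by
    rw [← Real.log_inv, ← one_div]; exact le_max_right _ _
  have h7 : -Real.log lam ≤ Real.posLog (1 / lam) := by
    rw [← Real.log_inv, ← one_div]; exact le_max_right _ _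
  rw [Real.log_div (by positivity) (by positivity), Real.log_mul (by positivity) (by positivity),
    Real.log_mul (by positivity) (by positivity), Real.log_pow, Real.log_pow, Real.log_pow]
  unfold logFactor
  push_cast
  linarith

/-- The Lipschitz constant of the features meets its budget as soon as the width exceeds
`n⁵ / (ε² λ⁴)`, up to constants and the factor `c`. -/
theorem sqrt_div_le_of_mul_le {c m τ B ε lam w n : ℝ} (hn : 0 < n) (hm : 0 < m) (hτ : 0 < τ)
    (hB : 0 < B) (hε : 0 < ε) (hlam : 0 < lam) (hw0 : 0 < w) (hw : w = ε * lam / (n * √n * B))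
    (hwidth : c * ((1728 * τ) ^ 2 * B ^ 4 * (n ^ 5 / (ε ^ 2 * lam ^ 4))) ≤ 2 * m) :
    √(c / (m + m)) ≤ w * lam / (192 * (9 * τ) * n * B) := by
  have e2 : w ^ 2 = ε ^ 2 * lam ^ 2 / (n ^ 3 * B ^ 2) := by
    rw [hw, div_pow, mul_pow, mul_pow, mul_pow, Real.sq_sqrt hn.le]
    ring
  have e1 : (w * lam / (192 * (9 * τ) * n * B)) ^ 2 * ((1728 * τ) ^ 2 * B ^ 4 *
      (n ^ 5 / (ε ^ 2 * lam ^ 4))) = 1 := by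
    rw [div_pow, mul_pow w, e2]
    field_simp
    norm_num
  rw [Real.sqrt_le_left (by positivity), div_le_iff₀ (by positivity)]
  calc c = c * ((1728 * τ) ^ 2 * B ^ 4 * (n ^ 5 / (ε ^ 2 * lam ^ 4))) *
        (w * lam / (192 * (9 * τ) * n * B)) ^ 2 := by
          rw [mul_assoc, mul_comm (_ * (_ / _)), e1, mul_one]
    _ ≤ 2 * m * (w * lam / (192 * (9 * τ) * n * B)) ^ 2 :=
        mul_le_mul_of_nonneg_right hwidth (sq_nonneg _)
    _ = _ := by ring

/-- The conclusion for a single initialization with bounded outer weights and Gram matrix close to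
its mean. The accuracy scale `w = ε λ / (n^{3/2} B)` turns an entrywise error `w / 4` of the Gram
matrix into an error `ε / 4` of the residual. -/
theorem norm_residual_sub_exp_le_of_good_initialization {m d n : ℕ} {σ : ℝ → ℝ}
    {𝒜 𝒲 ℬ ℬ' : Measure ℝ} {x : Fin n → EuclideanSpace ℝ (Fin d)}
    {fstar : EuclideanSpace ℝ (Fin d) → ℝ} {M B s₁ s₂ τ T ε w lam : ℝ} (hn : 0 < n) (hm : 0 < m)
    (hσ : ContDiff ℝ 2 σ) (h1 : ∀ z, |deriv σ z| ≤ s₁) (h2 : ∀ z, |deriv (deriv σ) z| ≤ s₂)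
    (hx : ∀ i, ‖x i‖ ≤ M) (hB : ∀ i, |fstar (x i)| ≤ B) (hτ : 1 ≤ τ)
    (hH : ∀ i, ntkGram σ 𝒜 𝒲 ℬ ℬ' m x i i ≤ 7 * τ) (hlam0 : 0 < lam)
    (hlam : lam = lambdaMin σ 𝒜 𝒲 ℬ ℬ' m x) (hlamτ : lam ≤ 7 * τ)
    (hε : 0 < ε) (hεB : ε < 2 * B * √n) (hw : w = ε * lam / (n * √n * B))
    (hwidth : ((3 * (M ^ 2 + 1) * s₁ ^ 2 + 2 * (M ^ 2 + 1) ^ 2 * s₂ ^ 2) * (1 + T ^ 2)) *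
      ((1728 * τ) ^ 2 * B ^ 4 * (n ^ 5 / (ε ^ 2 * lam ^ 4))) ≤ 2 * m)
    {ω : ParamIdx (Fin m) d → ℝ} (hωT : ∀ ℓ, |ω (Sum.inl ℓ)| ≤ T)
    (hωH : ∀ i j, |inner ℝ (gradNetwork σ (double ω) (x i)) (gradNetwork σ (double ω) (x j)) -
          ntkGram σ 𝒜 𝒲 ℬ ℬ' m x i j| ≤ w / 8)
    {θ : ℝ → Param (Fin m ⊕ Fin m) d} (hθ : IsGradientFlow σ x fstar (double ω) θ) {t : ℝ}
    (ht : 0 ≤ t) :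
    ‖residual σ x fstar (θ t) - WithLp.toLp 2
      (NormedSpace.exp (-(t • ntkGramNormalized σ 𝒜 𝒲 ℬ ℬ' m x)) *ᵥ
        WithLp.ofLp (-labels x fstar))‖ ≤ ε := by
  have hn' : (0 : ℝ) < n := by exact_mod_cast hn
  have hn1 : (1 : ℝ) ≤ n := by exact_mod_cast hn
  have hm' : (0 : ℝ) < m := by exact_mod_cast hm
  have hsn : 0 < √(n : ℝ) := Real.sqrt_pos.2 hn'
  have hsn2 : √(n : ℝ) ^ 2 = n := Real.sq_sqrt hn'.le
  have hB0 : 0 < B := by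
    by_contra h
    have : 2 * B * √n ≤ 0 := mul_nonpos_of_nonpos_of_nonneg (by linarith) hsn.le
    linarith
  have hw0 : 0 < w := by rw [hw]; positivity
  have hwlam : n * w ≤ 2 * lam := by
    rw [hw, mul_div_assoc', div_le_iff₀ (by positivity)]
    have := mul_le_mul_of_nonneg_left hεB.le (mul_pos hn' hlam0).le
    nlinarith
  have hwτ : w ≤ 14 * τ := by nlinarith
  -- `κ² = 9 τ` dominates the diagonal `7 τ + w / 8` of the Gram matrix at initialization
  set κ := 3 * √τ with hκdef
  have hκ0 : 0 < κ := by positivity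
  have hκ2 : κ ^ 2 = 9 * τ := by rw [hκdef, mul_pow, Real.sq_sqrt (by linarith)]; norm_num
  have hκρ : 3 * κ * (w / (24 * κ)) = w / 8 := by field_simp; norm_num
  have hσd : Differentiable ℝ σ := hσ.differentiable (by norm_num)
  set c := (3 * (M ^ 2 + 1) * s₁ ^ 2 + 2 * (M ^ 2 + 1) ^ 2 * s₂ ^ 2) * (1 + T ^ 2) with hc
  have hc0 : 0 ≤ c := by positivity
  have hA := ntkGram_isHermitian σ 𝒜 𝒲 ℬ ℬ' m x
  have hΛ : √(c / (m + m)) ≤ w * lam / (192 * κ ^ 2 * n * B) := by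
    rw [hκ2]
    exact sqrt_div_le_of_mul_le hn' hm' (by linarith) hB0 hε hlam0 hw0 hw hwidth
  have key := norm_residual_sub_exp_le_of_lazy (f := fun i θ => network σ θ (x i))
    (g := fun i θ => gradNetwork σ θ (x i)) (y := fun i => fstar (x i)) (A :=
      ntkGram σ 𝒜 𝒲 ℬ ℬ' m x) (l := lam) (η := w / 8) (κ := κ) (ρ := w / (24 * κ))
    (Λ := √(c / (m + m))) (Y := B * √n) (lam := hA.eigenvalues) hn
    (fun i θ => hasGradientAt_network hσd θ (x i)) (fun i => continuous_gradNetwork hσ (x i))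
    (hθ.hasDerivWithinAt hσd) hA.eigenvectorBasis hA.mulVec_eigenvectorBasis hlam0
    (fun i => ?_) (fun i j => ?_) (fun i => ?_) (by positivity) ?_ (by positivity)
    (fun i ϑ => ?_) ?_ ?_ ?_ t ht
  · rw [hκρ] at key
    have h0 : residual σ x fstar (θ 0) = -labels x fstar := by rw [hθ.1, residual_double]
    have h0' : (fun i => network σ (θ 0) (x i) - fstar (x i)) = WithLp.ofLp (-labels x fstar) := by
      rw [← h0]; rfl
    rw [h0'] at key
    refine key.trans ?_
    have : n * (w / 8 + w / 8) * (B * √n) / lam = ε / 4 := by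
      rw [hw]; field_simp; norm_num
    rw [this]
    linarith
  · rw [hlam]
    exact ciInf_le (Set.finite_range _).bddBelow i
  · rw [hθ.1, Matrix.gram_apply]
    exact hωH i j
  · refine le_of_sq_le_sq ?_ hκ0.le
    rw [hθ.1, ← real_inner_self_eq_norm_sq, hκ2]
    have e1 := (abs_le.1 (hωH i i)).2
    have e2 := hH i
    linarith
  · rw [div_le_iff₀ (by positivity), show κ * (24 * κ) = 24 * κ ^ 2 by ring, hκ2]
    linarith
  · rw [hθ.1]
    refine le_of_sq_le_sq ?_ (by positivity)
    rw [mul_pow, Real.sq_sqrt (by positivity)]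
    have := norm_gradNetwork_sub_sq_le (θ := ϑ) (θ₀ := double ω) (T := T) hσ h1 h2 (fun ℓ => ?_)
      (hx i)
    · simpa [Fintype.card_sum] using this
    · rcases ℓ with ℓ | ℓ
      · exact hωT ℓ
      · exact (abs_neg _).trans_le (hωT ℓ)
  · have : (WithLp.toLp 2 fun i => network σ (θ 0) (x i) - fstar (x i) :
        EuclideanSpace ℝ (Fin n)) = -labels x fstar := by
      rw [hθ.1, ← residual_double (σ := σ) ω]; rfl
    rw [this, norm_neg]
    exact norm_labels_le hn hB
  · refine (mul_le_mul_of_nonneg_right hΛ (by positivity)).trans (le_of_eq ?_)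
    rw [mul_assoc (4 * κ), show √(n : ℝ) * (B * √n) = B * √n ^ 2 by ring, hsn2]
    field_simp
    norm_num
  · rw [hκρ]
    linarith

/-! ### The width condition -/

/-- The constant of the width condition, before the factor that absorbs `log m`; the squared
Lipschitz constant of the features is at most `c (1 + T²) / (2m)` when the outer weights are bounded
by `T`. -/
def widthScale (c τ B κ : ℝ) : ℝ :=
  c * (1728 * τ) ^ 2 * B ^ 4 * κ ^ 2 + 6272 * (32 * (6 * Real.exp 6)) * τ ^ 4 * B ^ 2 + 1

theorem log_four_le_two : Real.log 4 ≤ 2 := by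
  rw [show (4 : ℝ) = 2 ^ 2 by norm_num, Real.log_pow]
  have := Real.log_two_lt_d9
  push_cast
  linarith

section Width

variable {d n m : ℕ} {c τ B κ ε lam δ : ℝ}

theorem widthScale_pos (hc : 0 ≤ c) : 0 < widthScale c τ B κ := by
  unfold widthScale
  positivity

/-- The width makes the feature map nearly constant when the outer weights are bounded by
`T = κ √(log (4m / δ))`. -/
theorem width_le_of_mul_le (hd : 1 ≤ d) (hn : 1 ≤ n) (hm : 0 < m) (hc : 0 ≤ c) (hκ : 1 ≤ κ)
    (hε : 0 < ε) (hlam : 0 < lam) (hδ : 0 < δ) (hδ1 : δ < 1)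
    (hmL : widthScale c τ B κ * (d * (n : ℝ) ^ 5 / (ε ^ 2 * lam ^ 4)) *
      (3 * logFactor d n ε lam δ + Real.log m) ≤ m) :
    (c * (1 + (κ * √(Real.log (4 * m / δ))) ^ 2)) *
      ((1728 * τ) ^ 2 * B ^ 4 * (n ^ 5 / (ε ^ 2 * lam ^ 4))) ≤ 2 * m := by
  have hd' : (1 : ℝ) ≤ d := by exact_mod_cast hd
  have hn' : (0 : ℝ) < n := by exact_mod_cast hn
  have hm' : (1 : ℝ) ≤ m := by exact_mod_cast hm
  have hL := one_le_logFactor d n (ε := ε) (lam := lam) hδ hδ1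
  have hlm : 0 ≤ Real.log m := Real.log_natCast_nonneg m
  have h4 : 1 ≤ 4 * m / δ := by rw [le_div_iff₀ hδ]; linarith
  have hlog : Real.log (4 * m / δ) = Real.log 4 + Real.log m + Real.log (1 / δ) := by
    rw [Real.log_div (by positivity) hδ.ne', Real.log_mul (by norm_num) (by positivity),
      one_div, Real.log_inv]
    ring
  have hδL : 1 + Real.log (1 / δ) ≤ logFactor d n ε lam δ := by
    have h1 : 0 ≤ Real.log d := Real.log_natCast_nonneg d
    have h2 : 0 ≤ Real.log n := Real.log_natCast_nonneg n
    have h4 := Real.posLog_nonneg (x := 1 / ε)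
    have h5 := Real.posLog_nonneg (x := 1 / lam)
    unfold logFactor
    linarith
  have hT : 1 + (κ * √(Real.log (4 * m / δ))) ^ 2 ≤
      κ ^ 2 * (3 * logFactor d n ε lam δ + Real.log m) := by
    rw [mul_pow, Real.sq_sqrt (Real.log_nonneg h4), hlog]
    have h1 : 1 ≤ κ ^ 2 := one_le_pow₀ hκ
    have h2 := log_four_le_two
    have : κ ^ 2 * (1 + (Real.log 4 + Real.log m + Real.log (1 / δ))) ≤
        κ ^ 2 * (3 * logFactor d n ε lam δ + Real.log m) :=
      mul_le_mul_of_nonneg_left (by linarith) (by positivity)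
    linarith
  set X₀ := (n : ℝ) ^ 5 / (ε ^ 2 * lam ^ 4) with hX₀
  have hX : d * (n : ℝ) ^ 5 / (ε ^ 2 * lam ^ 4) = d * X₀ := mul_div_assoc _ _ _
  have hX0 : 0 ≤ X₀ := by positivity
  rw [hX] at hmL
  have hD0 : 0 ≤ widthScale c τ B κ := (widthScale_pos hc).le
  have hD : c * (1728 * τ) ^ 2 * B ^ 4 * κ ^ 2 ≤ widthScale c τ B κ := by
    unfold widthScale
    have : 0 ≤ 6272 * (32 * (6 * Real.exp 6)) * τ ^ 4 * B ^ 2 := by positivity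
    linarith
  calc (c * (1 + (κ * √(Real.log (4 * m / δ))) ^ 2)) * ((1728 * τ) ^ 2 * B ^ 4 * X₀)
      ≤ (c * (κ ^ 2 * (3 * logFactor d n ε lam δ + Real.log m))) *
          ((1728 * τ) ^ 2 * B ^ 4 * X₀) := by gcongr
    _ = (c * (1728 * τ) ^ 2 * B ^ 4 * κ ^ 2) * (1 * X₀) *
          (3 * logFactor d n ε lam δ + Real.log m) := by ring
    _ ≤ widthScale c τ B κ * (d * X₀) * (3 * logFactor d n ε lam δ + Real.log m) := by gcongr
    _ ≤ m := hmL
    _ ≤ 2 * m := by linarith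

/-- The threshold `κ √(log (4m / δ))` makes the total failure probability of the `m` outer weights
at most `δ / 2`. -/
theorem outer_tail_le (hm : 0 < m) (hκ : 1 ≤ κ) (hδ : 0 < δ) (hδ1 : δ < 1) :
    m * (2 * Real.exp (-((κ * √(Real.log (4 * m / δ))) ^ 2 / κ ^ 2))) ≤ δ / 2 := by
  have hm' : (1 : ℝ) ≤ m := by exact_mod_cast hm
  have h4 : 1 ≤ 4 * m / δ := by rw [le_div_iff₀ hδ]; linarith
  rw [mul_pow, Real.sq_sqrt (Real.log_nonneg h4), mul_div_cancel_left₀ _ (by positivity),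
    Real.exp_neg, Real.exp_log (by positivity)]
  refine le_of_eq ?_
  field_simp
  norm_num

/-- The total failure probability of the `n²` Gram matrix entries, at accuracy
`ε λ / (8 n^{3/2} B)`, is at most `δ / 2`. The exponent needs only `n³ / (ε² λ²)` neurons, which
is fewer than available since `λ ≤ 7 τ`. -/
theorem gram_tail_le (hd : 1 ≤ d) (hn : 1 ≤ n) (hm : 0 < m) (hc : 0 ≤ c) (hτ : 1 ≤ τ) (hB : 0 < B)
    (hε : 0 < ε) (hlam : 0 < lam) (hlamτ : lam ≤ 7 * τ) (hδ : 0 < δ) (hδ1 : δ < 1)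
    (hmL : widthScale c τ B κ * (d * (n : ℝ) ^ 5 / (ε ^ 2 * lam ^ 4)) *
      (3 * logFactor d n ε lam δ + Real.log m) ≤ m) :
    (n : ℝ) ^ 2 * (2 * Real.exp (-(m * (ε * lam / (n * √n * B) / 8) ^ 2 /
      (32 * (6 * Real.exp 6) * τ ^ 2)))) ≤ δ / 2 := by
  have hd' : (1 : ℝ) ≤ d := by exact_mod_cast hd
  have hn1 : (1 : ℝ) ≤ n := by exact_mod_cast hn
  have hn' : (0 : ℝ) < n := by linarith
  have hm' : (1 : ℝ) ≤ m := by exact_mod_cast hm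
  have hL := one_le_logFactor d n (ε := ε) (lam := lam) hδ hδ1
  have hlm : 0 ≤ Real.log m := Real.log_natCast_nonneg m
  set C₁ := 32 * (6 * Real.exp 6) with hC₁
  have hC₁0 : 0 < C₁ := by positivity
  have hlog : Real.log (4 * n ^ 2 / δ) ≤ 2 * logFactor d n ε lam δ := by
    rw [Real.log_div (by positivity) hδ.ne', Real.log_mul (by norm_num) (by positivity),
      Real.log_pow]
    have h1 : 0 ≤ Real.log d := Real.log_natCast_nonneg d
    have h2 : 0 ≤ Real.log (1 / δ) := Real.log_nonneg (by rw [le_div_iff₀ hδ]; linarith)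
    have h3 : Real.log (1 / δ) = -Real.log δ := by rw [one_div, Real.log_inv]
    have h4 := Real.posLog_nonneg (x := 1 / ε)
    have h5 := Real.posLog_nonneg (x := 1 / lam)
    have h6 := log_four_le_two
    unfold logFactor
    push_cast
    linarith
  set X₀ := (n : ℝ) ^ 5 / (ε ^ 2 * lam ^ 4) with hX₀
  have hX : d * (n : ℝ) ^ 5 / (ε ^ 2 * lam ^ 4) = d * X₀ := mul_div_assoc _ _ _
  have hX0 : 0 < X₀ := by positivity
  rw [hX] at hmL
  have hD0 : 0 ≤ widthScale c τ B κ := (widthScale_pos hc).le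
  have hD : 6272 * C₁ * τ ^ 4 * B ^ 2 ≤ widthScale c τ B κ := by
    unfold widthScale
    have : 0 ≤ c * (1728 * τ) ^ 2 * B ^ 4 * κ ^ 2 := by positivity
    linarith
  have hbig : 6272 * C₁ * τ ^ 4 * B ^ 2 * X₀ * logFactor d n ε lam δ ≤ m := by
    calc 6272 * C₁ * τ ^ 4 * B ^ 2 * X₀ * logFactor d n ε lam δ
        = 6272 * C₁ * τ ^ 4 * B ^ 2 * (1 * X₀) * logFactor d n ε lam δ := by ring
      _ ≤ widthScale c τ B κ * (d * X₀) * (3 * logFactor d n ε lam δ + Real.log m) := by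
          gcongr
          linarith
      _ ≤ m := hmL
  have hη : (ε * lam / (n * √n * B) / 8) ^ 2 = n ^ 2 / (64 * B ^ 2 * X₀ * lam ^ 2) := by
    rw [div_pow, div_pow, mul_pow, mul_pow, mul_pow, Real.sq_sqrt hn'.le, hX₀]
    field_simp
    norm_num
  have hexp : Real.log (4 * n ^ 2 / δ) ≤
      m * (ε * lam / (n * √n * B) / 8) ^ 2 / (C₁ * τ ^ 2) := by
    refine hlog.trans ?_
    rw [le_div_iff₀ (by positivity), hη, ← mul_div_assoc, le_div_iff₀ (by positivity),
      ← mul_assoc]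
    have hlam2 : lam ^ 2 ≤ (7 * τ) ^ 2 := by gcongr
    calc 2 * logFactor d n ε lam δ * (C₁ * τ ^ 2) * (64 * B ^ 2 * X₀) * lam ^ 2
        ≤ 2 * logFactor d n ε lam δ * (C₁ * τ ^ 2) * (64 * B ^ 2 * X₀) * (7 * τ) ^ 2 := by gcongr
      _ = 6272 * C₁ * τ ^ 4 * B ^ 2 * X₀ * logFactor d n ε lam δ * 1 := by ring
      _ ≤ m * n ^ 2 := by
        have : (1 : ℝ) ≤ n ^ 2 := one_le_pow₀ hn1
        gcongr
  have h7 : Real.exp (-(m * (ε * lam / (n * √n * B) / 8) ^ 2 / (C₁ * τ ^ 2))) ≤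
      (4 * n ^ 2 / δ)⁻¹ := by
    rw [← Real.exp_log (x := 4 * n ^ 2 / δ) (by positivity), ← Real.exp_neg]
    exact Real.exp_le_exp.2 (neg_le_neg hexp)
  calc _ ≤ (n : ℝ) ^ 2 * (2 * (4 * n ^ 2 / δ)⁻¹) := by gcongr
    _ = δ / 2 := by field_simp; norm_num

end Width

theorem lambdaMin_le_apply {σ : ℝ → ℝ} {𝒜 𝒲 ℬ ℬ' : Measure ℝ} {m d n : ℕ}
    (x : Fin n → EuclideanSpace ℝ (Fin d)) (i : Fin n) :
    lambdaMin σ 𝒜 𝒲 ℬ ℬ' m x ≤ ntkGram σ 𝒜 𝒲 ℬ ℬ' m x i i := by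
  have hA := ntkGram_isHermitian σ 𝒜 𝒲 ℬ ℬ' m x
  have h := inner_mulVec_ge (lam := hA.eigenvalues) hA.eigenvectorBasis
    hA.mulVec_eigenvectorBasis (l := lambdaMin σ 𝒜 𝒲 ℬ ℬ' m x)
    (fun i => ciInf_le (Set.finite_range _).bddBelow i) (EuclideanSpace.single i 1)
  simpa [EuclideanSpace.inner_single_left] using h

/-- If the accuracy is at least the diameter of the ball that contains both trajectories, nothing
has to be known about the width. -/
theorem norm_residual_sub_exp_le_of_le {σ : ℝ → ℝ} {𝒜 𝒲 ℬ ℬ' : Measure ℝ} {m d n : ℕ}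
    {x : Fin n → EuclideanSpace ℝ (Fin d)} {fstar : EuclideanSpace ℝ (Fin d) → ℝ} {B ε : ℝ}
    (hn : 0 < n) (hσ : Differentiable ℝ σ) (hB : ∀ i, |fstar (x i)| ≤ B)
    (hlam : 0 ≤ lambdaMin σ 𝒜 𝒲 ℬ ℬ' m x) (hε : 2 * B * √n ≤ ε)
    {ω : ParamIdx (Fin m) d → ℝ} {θ : ℝ → Param (Fin m ⊕ Fin m) d}
    (hθ : IsGradientFlow σ x fstar (double ω) θ) {t : ℝ} (ht : 0 ≤ t) :
    ‖residual σ x fstar (θ t) - WithLp.toLp 2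
      (NormedSpace.exp (-(t • ntkGramNormalized σ 𝒜 𝒲 ℬ ℬ' m x)) *ᵥ
        WithLp.ofLp (-labels x fstar))‖ ≤ ε := by
  have hA := ntkGram_isHermitian σ 𝒜 𝒲 ℬ ℬ' m x
  have h1 := norm_residual_le hn hσ hθ ht
  rw [residual_double, norm_neg] at h1
  have h2 := norm_exp_neg_smul_mulVec_le (A := ntkGramNormalized σ 𝒜 𝒲 ℬ ℬ' m x)
    (lam := fun i => 1 / (n : ℝ) * hA.eigenvalues i) hA.eigenvectorBasis
    (fun i => by
      rw [ntkGramNormalized, Matrix.smul_mulVec, hA.mulVec_eigenvectorBasis, smul_smul])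
    (fun i => mul_nonneg (by positivity)
      (hlam.trans (ciInf_le (Set.finite_range _).bddBelow i))) ht (-labels x fstar)
  rw [norm_neg] at h2
  have h3 := norm_labels_le hn hB
  refine (norm_sub_le _ _).trans ?_
  linarith

end ShallowNTK

end

theorem theorem3p3 :
    -- `k` is the exponent of the logarithmic factors, `C` the constant of the width conditions
    ∃ k : ℕ, ∀ M B K s₀ s₁ s₂ : ℝ, ∃ C : ℝ, 0 < C ∧
    -- activation function
    ∀ σ : ℝ → ℝ, ContDiff ℝ 2 σ → |σ 0| ≤ s₀ → (∀ z, |deriv σ z| ≤ s₁) →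
      (∀ z, |deriv (deriv σ) z| ≤ s₂) →
    -- laws of the initial parameters
    ∀ 𝒜 𝒲 ℬ ℬ' : Measure ℝ,
      ShallowNTK.IsStdSubgaussian K 𝒜 → ShallowNTK.IsStdSubgaussian K 𝒲 →
      ShallowNTK.IsStdSubgaussian K ℬ → ShallowNTK.IsStdSubgaussian K ℬ' →
    -- training data
    ∀ d n : ℕ, 1 ≤ d → 1 ≤ n →
    ∀ x : Fin n → EuclideanSpace ℝ (Fin d), (∀ i, ‖x i‖ ≤ M) →
    ∀ fstar : EuclideanSpace ℝ (Fin d) → ℝ, (∀ i, |fstar (x i)| ≤ B) →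
    -- accuracy, failure probability and width
    ∀ ε δ : ℝ, 0 < ε → 0 < δ → δ < 1 →
    ∀ m : ℕ, 0 < ShallowNTK.lambdaMin σ 𝒜 𝒲 ℬ ℬ' m x →
      C * (d * (n : ℝ) ^ 5 / (ε ^ 2 * ShallowNTK.lambdaMin σ 𝒜 𝒲 ℬ ℬ' m x ^ 4)) *
        ShallowNTK.logFactor d n ε (ShallowNTK.lambdaMin σ 𝒜 𝒲 ℬ ℬ' m x) δ ^ k ≤ m →
      C * (Real.log (C / δ) + d * (1 + Real.log d) ^ k) ≤ m →
    -- an event of probability at least `1 - δ` over the initialization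
    ∃ E : Set (ShallowNTK.ParamIdx (Fin m) d → ℝ), MeasurableSet E ∧
      ENNReal.ofReal (1 - δ) ≤ ShallowNTK.initLaw 𝒜 𝒲 ℬ ℬ' m d E ∧
      ∀ ω ∈ E,
        (∃ θ : ℝ → ShallowNTK.Param (Fin m ⊕ Fin m) d,
          ShallowNTK.IsGradientFlow σ x fstar (ShallowNTK.double ω) θ) ∧
        ∀ θ : ℝ → ShallowNTK.Param (Fin m ⊕ Fin m) d,
          ShallowNTK.IsGradientFlow σ x fstar (ShallowNTK.double ω) θ →
          (∃ Δ : ℝ → EuclideanSpace ℝ (Fin n),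
            (∀ t, 0 ≤ t → ShallowNTK.residual σ x fstar (θ t) =
              WithLp.toLp 2
                (NormedSpace.exp (-(t • ShallowNTK.ntkGramNormalized σ 𝒜 𝒲 ℬ ℬ' m x)) *ᵥ
                  (WithLp.ofLp (-ShallowNTK.labels x fstar))) + Δ t) ∧
            ∀ t, 0 ≤ t → ‖Δ t‖ ≤ ε) ∧
          -- for every orthonormal system `v` of eigenvectors of the normalized Gram matrix
          ∀ (v : Fin n → EuclideanSpace ℝ (Fin n)) (lam : Fin n → ℝ), Orthonormal ℝ v →
            (∀ i, ShallowNTK.ntkGramNormalized σ 𝒜 𝒲 ℬ ℬ' m x *ᵥ (WithLp.ofLp (v i)) =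
              lam i • WithLp.ofLp (v i)) →
            ∀ t, 0 ≤ t →
              |‖ShallowNTK.residual σ x fstar (θ t)‖ -
                √(∑ i, Real.exp (-2 * lam i * t) *
                  |inner ℝ (ShallowNTK.labels x fstar) (v i)| ^ 2)| ≤ ε := by
  open ShallowNTK in
  refine ⟨1, fun M B K s₀ s₁ s₂ => ?_⟩
  set τ := kernelScale M K s₀ s₁ with hτdef
  have hτ : 1 ≤ τ := one_le_kernelScale M K s₀ s₁
  set c := 3 * (M ^ 2 + 1) * s₁ ^ 2 + 2 * (M ^ 2 + 1) ^ 2 * s₂ ^ 2 with hcdef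
  have hc : 0 ≤ c := by positivity
  set D := widthScale c τ B (|K| + 1) with hDdef
  have hD : 0 < D := widthScale_pos hc
  refine ⟨2 * D * (8 + |Real.log (2 * D)|), by positivity, ?_⟩
  intro σ hσ h0 h1 h2 𝒜 𝒲 ℬ ℬ' h𝒜 h𝒲 hℬ hℬ' d n hd hn x hx fstar hB ε δ hε hδ hδ1 m hlam hwidth _
  have hμ := isStdSubgaussian_coordLaw (m := m) (d := d) h𝒜 h𝒲 hℬ hℬ'
  have hσd : Differentiable ℝ σ := hσ.differentiable (by norm_num)
  set lam := lambdaMin σ 𝒜 𝒲 ℬ ℬ' m x with hlamdef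
  -- it suffices to bound the deviation of the residuals along every flow
  suffices h : ∃ E : Set (ParamIdx (Fin m) d → ℝ), MeasurableSet E ∧
      ENNReal.ofReal (1 - δ) ≤ initLaw 𝒜 𝒲 ℬ ℬ' m d E ∧ ∀ ω ∈ E, ∀ θ,
        IsGradientFlow σ x fstar (double ω) θ → ∀ t, 0 ≤ t →
          ‖residual σ x fstar (θ t) - WithLp.toLp 2
            (NormedSpace.exp (-(t • ntkGramNormalized σ 𝒜 𝒲 ℬ ℬ' m x)) *ᵥ
              WithLp.ofLp (-labels x fstar))‖ ≤ ε by
    obtain ⟨E, hE, hPE, h⟩ := h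
    refine ⟨E, hE, hPE, fun ω hω => ⟨exists_isGradientFlow hσ x fstar _, fun θ hθ => ⟨?_, ?_⟩⟩⟩
    · exact ⟨_, fun t _ => (add_sub_cancel _ _).symm, h ω hω θ hθ⟩
    · exact fun v lam hv hG t ht => abs_norm_sub_sqrt_le hn (h ω hω θ hθ t ht) hv hG
  -- below `2 B √n` the accuracy is attained by the tangent kernel regime, above it for trivial
  -- reasons
  rcases le_or_gt (2 * B * √n) ε with hεB | hεB
  · have := isProbabilityMeasure_initLaw hμ
    refine ⟨Set.univ, MeasurableSet.univ, ?_, fun ω _ θ hθ t ht =>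
      norm_residual_sub_exp_le_of_le hn hσd hB hlam.le hεB hθ ht⟩
    rw [measure_univ]
    exact ENNReal.ofReal_le_one.2 (by linarith)
  have hd' : (0 : ℝ) < d := by exact_mod_cast hd
  have hn' : (0 : ℝ) < n := by exact_mod_cast hn
  have hn1 : (1 : ℝ) ≤ n := by exact_mod_cast hn
  have hsn : 0 < √(n : ℝ) := Real.sqrt_pos.2 hn'
  have hB0 : 0 < B := by
    by_contra h
    have : 2 * B * √n ≤ 0 := mul_nonpos_of_nonpos_of_nonneg (by linarith) hsn.le
    linarith
  have hL := one_le_logFactor d n (ε := ε) (lam := lam) hδ hδ1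
  have hX : 0 < d * (n : ℝ) ^ 5 / (ε ^ 2 * lam ^ 4) := by positivity
  rw [pow_one] at hwidth
  have hm : 0 < m := by
    have : (0 : ℝ) < m := lt_of_lt_of_le (by positivity) hwidth
    exact_mod_cast this
  have hmL := mul_log_le_of_mul_le hD hX hL (log_width_le_logFactor hd hn hε hlam hδ hδ1) hwidth
  have hH : ∀ i, ntkGram σ 𝒜 𝒲 ℬ ℬ' m x i i ≤ 7 * τ := fun i =>
    (abs_le.1 (abs_ntk_le hμ hσd h0 h1 (hx i) (hx i))).2
  have hlamτ : lam ≤ 7 * τ := (lambdaMin_le_apply x ⟨0, hn⟩).trans (hH _)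
  have hκ : 1 ≤ |K| + 1 := by linarith [abs_nonneg K]
  have hη : ε * lam / (n * √n * B) / 8 ≤ 48 * τ := by
    rw [div_div, div_le_iff₀ (by positivity)]
    calc ε * lam ≤ 2 * B * √n * (7 * τ) := by gcongr
      _ = 14 * τ * 1 * (√n * B) := by ring
      _ ≤ 384 * τ * n * (√n * B) := by gcongr; norm_num
      _ = _ := by ring
  obtain ⟨E, hE, hPE, h⟩ := exists_initialization_event (δ := δ) hm hμ hσd h0 h1 hx
    (η := ε * lam / (n * √n * B) / 8) (T := (|K| + 1) * √(Real.log (4 * m / δ))) (by positivity) hη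
    (by positivity) (outer_tail_le hm hκ hδ hδ1)
    (gram_tail_le hd hn hm hc hτ hB0 hε hlam hlamτ hδ hδ1 hmL)
  exact ⟨E, hE, hPE, fun ω hω θ hθ t ht =>
    norm_residual_sub_exp_le_of_good_initialization hn hm hσ h1 h2 hx hB hτ hH hlam rfl hlamτ hε hεB
      rfl (width_le_of_mul_le hd hn hm hc hκ hε hlam hδ hδ1 hmL) (h ω hω).1 (h ω hω).2 hθ ht⟩
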